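/- **Setting.** Let $p=p_n\ge 2$ and, for every $n$, let $X^1,\dots,X^n$ be independent random vectors in $\mathbb R^{p}$ with a common law (depending on $n$) that has mean zero and covariance matrix $\Sigma_0$; let $X$ be the $n\times p$ matrix with rows $X^1,\dots,X^n$, let $X_j$ be its $j$-th column and $X_{-j}$ the matrix without this column, and let $\hat\Sigma:=X^TX/n$. Fix constants $L\ge 1$ and $K>0$ (not depending on $n$) and assume: * (bounded spectrum) $\Theta_0:=\Sigma_0^{-1}$ exists and $1/L\le\Lambda_{\min}(\Theta_0)\le\Lambda_{\max}(\Theta_0)\le L$; * (sub-Gaussianity) $\mathbb E\exp(|\alpha^TX^i|^2/K^2)\le 2$ for all $\alpha\in\mathbb R^p$ with $\|\alpha\|_2=1$ and all $i$. Let $d:=\max\{1,\max_{j}\operatorname{card}\{i\ne j:\Theta^0_{ij}\ne 0\}\}$ and assume $d=o(\sqrt n/\log p)$. **Estimator.** Put $\hat W_{kk}:=\hat\Sigma_{kk}^{1/2}$. For $j=1,\dots,p$ let $\hat\gamma_j=(\hat\gamma_{j,k})_{k\neq j}$ be any measurable choice of a minimizer over $\gamma\in\mathbb R^{p-1}$ of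 $$\|X_j-X_{-j}\gamma\|_2/\sqrt n+2\lambda\sum_{k\ne j}\hat W_{kk}|\gamma_k| ,$$ and let $\hat\tau_j^2:=\|X_j-X_{-j}\hat\gamma_j\|_2^2/n$ and $\tilde\tau_j^2:=\hat\tau_j^2+\lambda\hat\tau_j\|\hat\gamma_j\|_1$. The nodewise square-root Lasso estimator $\hat\Theta$ is the $p\times p$ matrix whose $j$-th column has $j$-th entry $1/\tilde\tau_j^2$ and $k$-th entry $-\hat\gamma_{j,k}/\tilde\tau_j^2$ for $k\neq j$. Write $\|A\|_\infty:=\max_{i,j}|A_{ij}|$, let $\Theta^0_i$ be the $i$-th column of $\Theta_0$, and let $\sigma_{ij}^2:=n\operatorname{var}((\Theta^0_i)^T\hat\Sigma\,\Theta^0_j)$, $\sigma_{ij}\ge 0$. **Theorem.** There is a constant $C_0>0$ depending only on $L$ and $K$ such that the following holds in the above setting as $n\to\infty$, for every $\lambda=\lambda_n\asymp\sqrt{\log p/n}$ with a sufficiently large constant, i.e. whenever $C_0\sqrt{\log p/n}\le\lambda\le C_1\sqrt{\log p/n}$ for all large $n$ and some constant $C_1$. We have $$\hat\Theta+\hat\Theta^T-\hat\Theta^T\hat\Sigma\hat\Theta-\Theta_0=-\Theta_0(\hat\Sigma-\Sigma_0)\Theta_0+\mathrm{rem},$$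 where $\|\mathrm{rem}\|_\infty=\mathcal O_P(d\lambda^2)$ and $\|\mathrm{rem}\|_\infty=o_P(1/\sqrt n)$. Moreover, for all indices $i=i_n$, $j=j_n$ in $\{1,\dots,p\}$ for which $\sigma_{ij}$ stays bounded away from zero as $n\to\infty$, $$\sqrt n\,(\hat\Theta+\hat\Theta^T-\hat\Theta^T\hat\Sigma\hat\Theta-\Theta_0)_{ij}/\sigma_{ij}\rightsquigarrow\mathcal N(0,1).$$ -/

import Mathlib

open MeasureTheory ProbabilityTheory Filter Topology Asymptotics
open scoped Matrix

noncomputable section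

namespace NodewiseSqrtLasso

/-! ### Population quantities -/

section Population

variable {p : ℕ}

/-- The covariance matrix `Σ₀` of a random vector with law `P` on `ℝᵖ`. -/
def popCov (P : Measure (Fin p → ℝ)) : Matrix (Fin p) (Fin p) ℝ :=
  Matrix.of fun j k => cov[fun x => x j, fun x => x k; P]

/-- The precision matrix `Θ₀ = Σ₀⁻¹`. -/
def precision (P : Measure (Fin p → ℝ)) : Matrix (Fin p) (Fin p) ℝ :=
  (popCov P)⁻¹

/-- Bounded spectrum: `Σ₀` is invertible and all eigenvalues of the (symmetric real) matrix
`Θ₀ = Σ₀⁻¹` lie in `[1/L, L]`. -/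
def BoundedSpectrum (L : ℝ) (P : Measure (Fin p → ℝ)) : Prop :=
  IsUnit (popCov P) ∧ ∀ μ ∈ spectrum ℝ (precision P), 1 / L ≤ μ ∧ μ ≤ L

/-- Sub-Gaussianity with constant `K`: `E exp(|αᵀ X|² / K²) ≤ 2` for all unit vectors `α`.
The expectation is a Lebesgue integral with values in `[0, ∞]`. -/
def SubGaussian (K : ℝ) (P : Measure (Fin p → ℝ)) : Prop :=
  ∀ α : Fin p → ℝ, √(∑ k, α k ^ 2) = 1 →
    ∫⁻ x, ENNReal.ofReal (Real.exp (|α ⬝ᵥ x| ^ 2 / K ^ 2)) ∂P ≤ 2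

/-- `max_j card {i ≠ j : Θ i j ≠ 0}`, the maximal vertex degree of the graph of `Θ`. -/
def maxDegree (Θ : Matrix (Fin p) (Fin p) ℝ) : ℕ :=
  Finset.univ.sup fun j => Set.ncard {i | i ≠ j ∧ Θ i j ≠ 0}

/-- The sparsity parameter `d = max (1, maximal vertex degree)`. -/
def sparsity (P : Measure (Fin p → ℝ)) : ℕ :=
  max 1 (maxDegree (precision P))

end Population

/-! ### The estimators, for a data matrix with `n` rows (observations) and `p` columns -/

section Estimator

variable {n p : ℕ}

/-- The sample covariance matrix `XᵀX / n`. -/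
def sampleCov (X : Matrix (Fin n) (Fin p) ℝ) : Matrix (Fin p) (Fin p) ℝ :=
  (1 / (n : ℝ)) • (Xᵀ * X)

/-- The residual vector `X_j - X_{-j} γ`. -/
def residual (X : Matrix (Fin n) (Fin p) ℝ) (j : Fin p) (γ : {k : Fin p // k ≠ j} → ℝ) :
    Fin n → ℝ :=
  fun i => X i j - ∑ k : {k : Fin p // k ≠ j}, X i k * γ k

/-- The noise level `‖X_j - X_{-j} γ‖₂ / √n` of a coefficient vector. -/
def noiseLevel (X : Matrix (Fin n) (Fin p) ℝ) (j : Fin p) (γ : {k : Fin p // k ≠ j} → ℝ) : ℝ :=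
  √(∑ i, residual X j γ i ^ 2) / √(n : ℝ)

/-- The weights: square roots of the diagonal entries of the sample covariance matrix. -/
def weight (X : Matrix (Fin n) (Fin p) ℝ) (k : Fin p) : ℝ :=
  √(sampleCov X k k)

/-- The objective `‖X_j - X_{-j} γ‖₂ / √n + 2 λ ‖W_{-j} γ‖₁` of the `j`-th weighted
square-root Lasso. -/
def objective (X : Matrix (Fin n) (Fin p) ℝ) (lam : ℝ) (j : Fin p)
    (γ : {k : Fin p // k ≠ j} → ℝ) : ℝ :=
  noiseLevel X j γ + 2 * lam * ∑ k : {k : Fin p // k ≠ j}, |weight X k * γ k|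

/-- `γ` is a solution of the `j`-th weighted square-root Lasso. -/
def IsSqrtLasso (X : Matrix (Fin n) (Fin p) ℝ) (lam : ℝ) (j : Fin p)
    (γ : {k : Fin p // k ≠ j} → ℝ) : Prop :=
  ∀ γ' : {k : Fin p // k ≠ j} → ℝ, objective X lam j γ ≤ objective X lam j γ'

/-- `τ̃² = τ̂² + λ τ̂ ‖γ‖₁`, where `τ̂` is the noise level of `γ`. -/
def tauTildeSq (X : Matrix (Fin n) (Fin p) ℝ) (lam : ℝ) (j : Fin p)
    (γ : {k : Fin p // k ≠ j} → ℝ) : ℝ :=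
  noiseLevel X j γ ^ 2 + lam * noiseLevel X j γ * ∑ k, |γ k|

/-- The nodewise estimator: its `j`-th column has entry `1 / τ̃_j²` in position `j`
and `-γ_{j,k} / τ̃_j²` in position `k ≠ j`. -/
def nodewise (X : Matrix (Fin n) (Fin p) ℝ) (lam : ℝ)
    (γ : (j : Fin p) → {k : Fin p // k ≠ j} → ℝ) : Matrix (Fin p) (Fin p) ℝ :=
  Matrix.of fun k j =>
    if h : k = j then 1 / tauTildeSq X lam j (γ j)
    else -γ j ⟨k, h⟩ / tauTildeSq X lam j (γ j)

/-- The de-biased estimator `Θ + Θᵀ - Θᵀ S Θ`, with `Θ` the nodewise estimator and `S` the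
sample covariance matrix. -/
def debiased (X : Matrix (Fin n) (Fin p) ℝ) (lam : ℝ)
    (γ : (j : Fin p) → {k : Fin p // k ≠ j} → ℝ) : Matrix (Fin p) (Fin p) ℝ :=
  nodewise X lam γ + (nodewise X lam γ)ᵀ
    - (nodewise X lam γ)ᵀ * sampleCov X * nodewise X lam γ

/-- The entrywise supremum norm of a matrix. -/
def supNorm (A : Matrix (Fin p) (Fin p) ℝ) : ℝ :=
  ⨆ ij : Fin p × Fin p, |A ij.1 ij.2|

/-- The data matrix whose rows are the observations. -/
def dataMatrix {Ω : Type*} (X : Fin n → Ω → Fin p → ℝ) (ω : Ω) : Matrix (Fin n) (Fin p) ℝ :=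
  Matrix.of fun i k => X i ω k

/-- `σ_ij`, where `σ_ij² = n Var((Θ_i)ᵀ S Θ_j)` with `S` the sample covariance matrix and
`Θ_i`, `Θ_j` columns of `Θ`. -/
def asympSd {Ω : Type*} [MeasurableSpace Ω] (μ : Measure Ω) (X : Fin n → Ω → Fin p → ℝ)
    (Θ : Matrix (Fin p) (Fin p) ℝ) (i j : Fin p) : ℝ :=
  √((n : ℝ) * Var[fun ω => (fun k => Θ k i) ⬝ᵥ
    (sampleCov (dataMatrix X ω) *ᵥ fun k => Θ k j); μ])

end Estimator

/-! ### Stochastic orders, for random variables on possibly different probability spaces -/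

section Orders

/-- `Y_n = O_P(r_n)`. -/
def IsBigOP {Ω : ℕ → Type*} [∀ n, MeasurableSpace (Ω n)] (μ : ∀ n, Measure (Ω n))
    (Y : ∀ n, Ω n → ℝ) (r : ℕ → ℝ) : Prop :=
  ∀ ε : ℝ, 0 < ε → ∃ M : ℝ, ∀ᶠ n in atTop, (μ n).real {ω | M * r n < |Y n ω|} ≤ ε

/-- `Y_n = o_P(r_n)`. -/
def IsLittleOP {Ω : ℕ → Type*} [∀ n, MeasurableSpace (Ω n)] (μ : ∀ n, Measure (Ω n))
    (Y : ∀ n, Ω n → ℝ) (r : ℕ → ℝ) : Prop :=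
  ∀ ε : ℝ, 0 < ε → Tendsto (fun n => (μ n).real {ω | ε * r n < |Y n ω|}) atTop (𝓝 0)

end Orders

end NodewiseSqrtLasso

end

open NodewiseSqrtLasso

/-! Write `S` for the sample covariance, `T` for `Σ₀`, `Θ` for `Θ₀` and `D = Θ̂ - Θ`. Since `ΘT = TΘ
= 1`, the remainder is exactly `-Dᵀ(S-T)Θ - Θ(S-T)D - DᵀSD` (`debiased_sub_eq`): every term is
quadratic in small quantities. An entry of the first two is at most `‖(S-T)Θ‖_∞` times the `ℓ¹`
error of a column, and an entry of the third is controlled, by Cauchy-Schwarz, by the prediction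
errors of two columns. It suffices to have column errors of order `d s` in `ℓ¹` and `d s²` in
squared prediction norm, where `s ≍ √(log p / n)` (`CloseAt.column_error`, `supNorm_remainder_le`).

These bounds are deterministic on the event that `|aᵀ(S-T)b| ≤ ρ` for all coordinate vectors and
columns `a`, `b` of `Θ`. The `j`-th regression estimates `b₀ = θ/θ_j`, with `θ` the `j`-th column of
`Θ`, by `(1, -γ̂) = b₀ + Δ`. As `Tb₀` is a multiple of `e_j` and `Δ_j = 0`, the noise term `b₀ᵀSΔ`
is at most of order `ρ‖Δ‖₁`; comparing objectives at `b₀` and `b₀ + Δ` gives the rates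
(`CloseAt.rates`). No optimality conditions are needed, only minimality. The scale `τ̃²` is then
within `√d s` of `1/θ_j`, which is enough because `‖b₀‖₁` is of order `√d`.

The event has probability at least `1 - 8p^{2-q}` by a Bernstein inequality for products of
sub-Gaussian forms and a union bound (`measureReal_exists_testVec_le`). The subtle point is that `p`
need not tend to infinity, while the tuning constant must not depend on the tolerated failure
probability `ε`. For `p > 8/ε` a fixed level `ρ` dominated by `λ` suffices, and the error lies in
the usual cone. For `p ≤ 8/ε` a larger `ρ`, no longer dominated by `λ`, is needed; the cone is
replaced by `‖Δ‖₁² ≤ p‖Δ‖₂²`, whose constant is bounded in terms of `ε` (`isBigOP_remainder`).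

For the limit law, the linear term is a normalised row sum of i.i.d. centred variables with
uniformly bounded exponential moments. Its characteristic function converges
(`tendsto_charFun_row_sum`), and the remainder is `o_P(1/√n)`, so Slutsky's lemma and Lévy's
continuity theorem finish the proof. -/

namespace NodewiseSqrtLasso

/-! ### Deterministic analysis of one square-root Lasso regression -/

section Deterministic

variable {p : ℕ}

/-- The quadratic form of a matrix, in the bilinear version. -/
def bil (S : Matrix (Fin p) (Fin p) ℝ) (x y : Fin p → ℝ) : ℝ := x ⬝ᵥ S *ᵥ y

lemma bil_add_left (S : Matrix (Fin p) (Fin p) ℝ) (x y z : Fin p → ℝ) :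
    bil S (x + y) z = bil S x z + bil S y z := by
  simp [bil, add_dotProduct]

lemma bil_add_right (S : Matrix (Fin p) (Fin p) ℝ) (x y z : Fin p → ℝ) :
    bil S x (y + z) = bil S x y + bil S x z := by
  simp [bil, Matrix.mulVec_add, dotProduct_add]

lemma bil_smul_left (S : Matrix (Fin p) (Fin p) ℝ) (c : ℝ) (x y : Fin p → ℝ) :
    bil S (c • x) y = c * bil S x y := by
  simp [bil]

lemma bil_smul_right (S : Matrix (Fin p) (Fin p) ℝ) (c : ℝ) (x y : Fin p → ℝ) :
    bil S x (c • y) = c * bil S x y := by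
  simp [bil, Matrix.mulVec_smul]

lemma bil_sub_mat (S T : Matrix (Fin p) (Fin p) ℝ) (x y : Fin p → ℝ) :
    bil (S - T) x y = bil S x y - bil T x y := by
  simp [bil, Matrix.sub_mulVec]

lemma bil_comm {S : Matrix (Fin p) (Fin p) ℝ} (hS : S.IsSymm) (x y : Fin p → ℝ) :
    bil S x y = bil S y x := by
  unfold bil
  rw [Matrix.dotProduct_mulVec, ← Matrix.mulVec_transpose, hS.eq, dotProduct_comm]

lemma bil_single_single (S : Matrix (Fin p) (Fin p) ℝ) (i k : Fin p) :
    bil S (Pi.single i 1) (Pi.single k 1) = S i k := by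
  simp [bil]

lemma bil_single_left (S : Matrix (Fin p) (Fin p) ℝ) (i : Fin p) (x : Fin p → ℝ) :
    bil S (Pi.single i 1) x = (S *ᵥ x) i := by
  simp [bil]

lemma bil_self_add {S : Matrix (Fin p) (Fin p) ℝ} (hS : S.IsSymm) (x y : Fin p → ℝ) :
    bil S (x + y) (x + y) = bil S x x + 2 * bil S x y + bil S y y := by
  rw [bil_add_left, bil_add_right, bil_add_right, bil_comm hS y x]
  ring

lemma bil_sq_le {S : Matrix (Fin p) (Fin p) ℝ} (hS : S.IsSymm) (h0 : ∀ x, 0 ≤ bil S x x)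
    (x y : Fin p → ℝ) : bil S x y ^ 2 ≤ bil S x x * bil S y y := by
  have h := LinearMap.BilinForm.apply_mul_apply_le_of_forall_zero_le (Matrix.toBilin' S)
    (fun x => by rw [Matrix.toBilin'_apply']; exact h0 x) x y
  simp only [Matrix.toBilin'_apply'] at h
  change bil S x y * bil S y x ≤ bil S x x * bil S y y at h
  rw [bil_comm hS y x] at h
  rw [sq]
  exact h

lemma bil_self_add_le {S : Matrix (Fin p) (Fin p) ℝ} (hS : S.IsSymm) (h0 : ∀ x, 0 ≤ bil S x x)
    (x y : Fin p → ℝ) : bil S (x + y) (x + y) ≤ 2 * bil S x x + 2 * bil S y y := by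
  have h1 := h0 (x + (-1 : ℝ) • y)
  rw [bil_self_add hS] at h1 ⊢
  simp only [bil_smul_left, bil_smul_right] at h1
  linarith

/-- The `ℓ¹` norm of a vector. -/
def norm1 (x : Fin p → ℝ) : ℝ := ∑ k, |x k|

lemma norm1_nonneg (x : Fin p → ℝ) : 0 ≤ norm1 x := Finset.sum_nonneg fun _ _ => abs_nonneg _

lemma norm1_add_le (x y : Fin p → ℝ) : norm1 (x + y) ≤ norm1 x + norm1 y := by
  unfold norm1
  rw [← Finset.sum_add_distrib]
  exact Finset.sum_le_sum fun k _ => abs_add_le _ _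

lemma norm1_smul (c : ℝ) (x : Fin p → ℝ) : norm1 (c • x) = |c| * norm1 x := by
  simp [norm1, abs_mul, Finset.mul_sum]

lemma abs_dotProduct_le {x v : Fin p → ℝ} {ρ : ℝ} (h : ∀ k, x k = 0 ∨ |v k| ≤ ρ) :
    |x ⬝ᵥ v| ≤ ρ * norm1 x := by
  unfold norm1 dotProduct
  rw [Finset.mul_sum]
  refine (Finset.abs_sum_le_sum_abs _ _).trans (Finset.sum_le_sum fun k _ => ?_)
  rw [abs_mul, mul_comm ρ]
  rcases h k with h | h
  · simp [h]
  · exact mul_le_mul_of_nonneg_left h (abs_nonneg _)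

lemma abs_bil_le {A : Matrix (Fin p) (Fin p) ℝ} {ρ : ℝ} (h : ∀ i k, |A i k| ≤ ρ)
    (x y : Fin p → ℝ) : |bil A x y| ≤ ρ * norm1 y * norm1 x := by
  refine abs_dotProduct_le fun k => Or.inr ?_
  change |(fun l => A k l) ⬝ᵥ y| ≤ _
  rw [dotProduct_comm]
  exact abs_dotProduct_le fun l => Or.inr (h k l)

/-- The properties of a column `θ` of the precision matrix belonging to the covariance matrix `T`
that are used in the analysis of the `j`-th regression. -/
structure ColumnModel (L : ℝ) (d : ℕ) (T : Matrix (Fin p) (Fin p) ℝ) (θ : Fin p → ℝ)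
    (j : Fin p) : Prop where
  one_le : 1 ≤ L
  one_le_deg : 1 ≤ d
  coercive : ∀ x, (∑ k, x k ^ 2) ≤ L * bil T x x
  solve : T *ᵥ θ = Pi.single j 1
  lower : 1 / L ≤ θ j
  upper : θ j ≤ L
  sq_le : ∑ k, θ k ^ 2 ≤ L ^ 2
  supp : ({k | k ≠ j ∧ θ k ≠ 0} : Set (Fin p)).ncard ≤ d
  diag_lower : ∀ k, 1 / L ≤ T k k
  diag_upper : ∀ k, T k k ≤ L

/-- The matrix `S` is close to `T`, also when applied to `θ`. -/
structure CloseAt (ρ : ℝ) (S T : Matrix (Fin p) (Fin p) ℝ) (θ : Fin p → ℝ) : Prop where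
  symm : S.IsSymm
  nonneg : ∀ x, 0 ≤ bil S x x
  entry : ∀ i k, |(S - T) i k| ≤ ρ
  col : ∀ k, |((S - T) *ᵥ θ) k| ≤ ρ
  quad : |bil (S - T) θ θ| ≤ ρ

variable {L ρ lam s A : ℝ} {d : ℕ} {S T : Matrix (Fin p) (Fin p) ℝ} {θ b Δ : Fin p → ℝ} {j : Fin p}

lemma ColumnModel.theta_pos (h : ColumnModel L d T θ j) : 0 < θ j :=
  lt_of_lt_of_le (by have := h.one_le; positivity) h.lower

lemma ColumnModel.inv_le (h : ColumnModel L d T θ j) : (θ j)⁻¹ ≤ L := by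
  have := h.one_le
  rw [inv_le_comm₀ h.theta_pos (by linarith), ← one_div]
  exact h.lower

lemma ColumnModel.le_inv (h : ColumnModel L d T θ j) : 1 / L ≤ (θ j)⁻¹ := by
  have := h.one_le
  rw [one_div]
  exact inv_anti₀ h.theta_pos h.upper

lemma CloseAt.radius_nonneg (hc : CloseAt ρ S T θ) : 0 ≤ ρ := (abs_nonneg _).trans hc.quad

lemma CloseAt.abs_target_sub_le (hm : ColumnModel L d T θ j) (hc : CloseAt ρ S T θ) :
    |bil S ((θ j)⁻¹ • θ) ((θ j)⁻¹ • θ) - (θ j)⁻¹| ≤ L ^ 2 * ρ := by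
  have h1 := hm.theta_pos
  have h2 : bil T θ θ = θ j := by simp [bil, hm.solve]
  have h3 : bil S ((θ j)⁻¹ • θ) ((θ j)⁻¹ • θ) - (θ j)⁻¹
      = (θ j)⁻¹ ^ 2 * bil (S - T) θ θ := by
    rw [bil_sub_mat, h2, bil_smul_left, bil_smul_right]
    field_simp
  rw [h3, abs_mul, abs_of_nonneg (by positivity)]
  have := hm.inv_le
  have h4 : (0 : ℝ) ≤ (θ j)⁻¹ := by positivity
  exact mul_le_mul (by gcongr) hc.quad (abs_nonneg _) (by positivity)

lemma CloseAt.target_bounds (hm : ColumnModel L d T θ j) (hc : CloseAt ρ S T θ)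
    (hρ : ρ ≤ 1 / (2 * L)) :
    1 / (2 * L) ≤ bil S ((θ j)⁻¹ • θ) ((θ j)⁻¹ • θ) ∧
      bil S ((θ j)⁻¹ • θ) ((θ j)⁻¹ • θ) ≤ 2 * L := by
  have h1 := hm.theta_pos
  have hL := hm.one_le
  have h2 : bil T θ θ = θ j := by simp [bil, hm.solve]
  have h3 : bil S ((θ j)⁻¹ • θ) ((θ j)⁻¹ • θ)
      = (θ j)⁻¹ ^ 2 * (θ j + bil (S - T) θ θ) := by
    rw [bil_sub_mat, h2, bil_smul_left, bil_smul_right]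
    ring
  have h5 := abs_le.1 hc.quad
  have h6 : ρ ≤ θ j / 2 := by
    have := hm.lower
    have e : 1 / (2 * L) = (1 / L) / 2 := by field_simp
    linarith
  have h7 : (θ j)⁻¹ ^ 2 * (θ j / 2) = (θ j)⁻¹ / 2 := by field_simp
  have h8 : (θ j)⁻¹ ^ 2 * (2 * θ j) = 2 * (θ j)⁻¹ := by field_simp
  rw [h3]
  constructor
  · calc 1 / (2 * L) = (1 / L) / 2 := by field_simp
      _ ≤ (θ j)⁻¹ / 2 := by linarith [hm.le_inv]
      _ = (θ j)⁻¹ ^ 2 * (θ j / 2) := h7.symm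
      _ ≤ _ := by gcongr; linarith
  · calc (θ j)⁻¹ ^ 2 * (θ j + bil (S - T) θ θ) ≤ (θ j)⁻¹ ^ 2 * (2 * θ j) := by
          gcongr; linarith
      _ = 2 * (θ j)⁻¹ := h8
      _ ≤ 2 * L := by linarith [hm.inv_le]

/-- The target is orthogonal to `Δ` under `T`, because `T *ᵥ θ` is supported on `j`, where `Δ`
vanishes. Only the fluctuation of `S *ᵥ θ` off `j` remains. -/
lemma CloseAt.abs_cross_le (hm : ColumnModel L d T θ j) (hc : CloseAt ρ S T θ) (hΔ : Δ j = 0) :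
    |bil S ((θ j)⁻¹ • θ) Δ| ≤ L * ρ * norm1 Δ := by
  have h1 := hm.theta_pos
  rw [bil_comm hc.symm, bil_smul_right, abs_mul, abs_of_pos (by positivity), mul_assoc]
  have h2 : |bil S Δ θ| ≤ ρ * norm1 Δ := by
    refine abs_dotProduct_le fun k => ?_
    by_cases hk : k = j
    · left; rw [hk, hΔ]
    · right
      have := hc.col k
      rwa [Matrix.sub_mulVec, hm.solve, Pi.sub_apply, Pi.single_eq_of_ne hk, sub_zero] at this
  exact mul_le_mul hm.inv_le h2 (abs_nonneg _) (by linarith [hm.one_le])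

lemma sqrt_bounds {L x : ℝ} (hL : 1 ≤ L) (h1 : 1 / (2 * L) ≤ x) (h2 : x ≤ 2 * L) :
    1 / (2 * L) ≤ √x ∧ √x ≤ 2 * L := by
  constructor
  · refine Real.le_sqrt_of_sq_le (le_trans ?_ h1)
    have : 1 / (2 * L) ≤ 1 := by rw [div_le_one (by linarith)]; linarith
    have h0 : 0 ≤ 1 / (2 * L) := by positivity
    nlinarith
  · rw [Real.sqrt_le_left (by linarith)]
    nlinarith

lemma CloseAt.weight_bounds (hm : ColumnModel L d T θ j) (hc : CloseAt ρ S T θ)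
    (hρ : ρ ≤ 1 / (2 * L)) (k : Fin p) : 1 / (2 * L) ≤ √(S k k) ∧ √(S k k) ≤ 2 * L := by
  have hL := hm.one_le
  have h := abs_le.1 (hc.entry k k)
  rw [Matrix.sub_apply] at h
  have e : 1 / (2 * L) = (1 / L) / 2 := by field_simp
  have e1 : 1 / L ≤ 1 := by rw [div_le_one (by linarith)]; linarith
  have h1 := hm.diag_lower k
  have h2 := hm.diag_upper k
  exact sqrt_bounds hL (by linarith) (by linarith)

/-- The vector `b₀ + Δ` has a smaller penalised noise level than `b₀`. -/
def Improves (S : Matrix (Fin p) (Fin p) ℝ) (lam : ℝ) (b₀ Δ : Fin p → ℝ) : Prop :=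
  √(bil S (b₀ + Δ) (b₀ + Δ)) + 2 * lam * ∑ k, √(S k k) * |(b₀ + Δ) k|
    ≤ √(bil S b₀ b₀) + 2 * lam * ∑ k, √(S k k) * |b₀ k|

lemma Improves.sqrt_sub_le {b₀ : Fin p → ℝ} (h : Improves S lam b₀ Δ) :
    √(bil S (b₀ + Δ) (b₀ + Δ)) - √(bil S b₀ b₀) ≤
      2 * lam * ∑ k, √(S k k) * (|b₀ k| - |(b₀ + Δ) k|) := by
  unfold Improves at h
  simp only [mul_sub, Finset.sum_sub_distrib] at h ⊢
  linarith

/-- Convexity of the noise level: Cauchy-Schwarz gives `x y ≥ x² + b₀ᵀSΔ` for the noise levels `x`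
at `b₀` and `y` at `b₀ + Δ`. Divide by `x ≥ 1/(2L)`. -/
lemma CloseAt.sqrt_sub_ge (hm : ColumnModel L d T θ j) (hc : CloseAt ρ S T θ)
    (hρ : ρ ≤ 1 / (2 * L)) (hΔ : Δ j = 0) :
    -(2 * L ^ 2 * ρ * norm1 Δ) ≤ √(bil S ((θ j)⁻¹ • θ + Δ) ((θ j)⁻¹ • θ + Δ))
      - √(bil S ((θ j)⁻¹ • θ) ((θ j)⁻¹ • θ)) := by
  have hL := hm.one_le
  set b₀ := (θ j)⁻¹ • θ with hb₀
  obtain ⟨h1, h2⟩ := hc.target_bounds hm hρ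
  obtain ⟨h3, -⟩ := sqrt_bounds hL h1 h2
  have h4 := (abs_le.1 (hc.abs_cross_le hm hΔ)).1
  rw [← hb₀] at h1 h2 h3 h4
  set x := √(bil S b₀ b₀)
  set y := √(bil S (b₀ + Δ) (b₀ + Δ))
  have hx : x * x = bil S b₀ b₀ := Real.mul_self_sqrt (hc.nonneg _)
  have hcs : bil S b₀ b₀ + bil S b₀ Δ ≤ x * y := by
    rw [← bil_add_right, ← Real.sqrt_mul (hc.nonneg _)]
    exact Real.le_sqrt_of_sq_le (bil_sq_le hc.symm hc.nonneg _ _)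
  have hx0 : 0 < x := lt_of_lt_of_le (by positivity) h3
  have hN := norm1_nonneg Δ
  have hρ0 := hc.radius_nonneg
  have h5 : 1 ≤ 2 * L * x := by
    rw [div_le_iff₀ (by positivity)] at h3
    linarith
  have h6 : 0 ≤ x * (y - x + 2 * L ^ 2 * ρ * norm1 Δ) := by
    have : 0 ≤ L * ρ * norm1 Δ * (2 * L * x - 1) :=
      mul_nonneg (by positivity) (by linarith)
    nlinarith
  have := nonneg_of_mul_nonneg_right h6 hx0
  linarith

lemma ColumnModel.off_support (k : Fin p) (hk : ¬(k ≠ j ∧ θ k ≠ 0)) (hΔ : Δ j = 0) :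
    |((θ j)⁻¹ • θ) k| - |((θ j)⁻¹ • θ + Δ) k| = -|Δ k| := by
  by_cases hkj : k = j
  · subst hkj; simp [hΔ]
  · have : θ k = 0 := by by_contra h; exact hk ⟨hkj, h⟩
    simp [this]

/-- If the tuning parameter dominates the noise, the error lies in a cone. -/
lemma CloseAt.cone (hm : ColumnModel L d T θ j) (hc : CloseAt ρ S T θ)
    (hρ : ρ ≤ 1 / (2 * L)) (hlam : 0 < lam) (hρlam : 4 * L ^ 3 * ρ ≤ lam) (hΔ : Δ j = 0)
    (hmin : Improves S lam ((θ j)⁻¹ • θ) Δ) :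
    norm1 Δ ^ 2 ≤ 100 * L ^ 4 * d * ∑ k, Δ k ^ 2 := by
  classical
  have hL := hm.one_le
  have h1 := (hc.sqrt_sub_ge hm hρ hΔ).trans hmin.sqrt_sub_le
  set B := Finset.univ.filter fun k => k ≠ j ∧ θ k ≠ 0 with hB
  set NB := ∑ k ∈ B, |Δ k| with hNB
  have hsplit : NB + ∑ k ∈ Finset.univ.filter (fun k => ¬(k ≠ j ∧ θ k ≠ 0)), |Δ k| = norm1 Δ :=
    Finset.sum_filter_add_sum_filter_not _ _ _
  have h2 : ∑ k, √(S k k) * (|((θ j)⁻¹ • θ) k| - |((θ j)⁻¹ • θ + Δ) k|) ≤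
      2 * L * NB - 1 / (2 * L) * (norm1 Δ - NB) := by
    rw [← Finset.sum_filter_add_sum_filter_not _ (fun k => k ≠ j ∧ θ k ≠ 0), sub_eq_add_neg]
    refine add_le_add ?_ ?_
    · rw [hNB, Finset.mul_sum]
      refine Finset.sum_le_sum fun k _ => ?_
      have h3 : |((θ j)⁻¹ • θ) k| - |((θ j)⁻¹ • θ + Δ) k| ≤ |Δ k| := by
        have := abs_sub_abs_le_abs_sub (((θ j)⁻¹ • θ) k) (((θ j)⁻¹ • θ + Δ) k)
        simpa using this
      exact (mul_le_mul_of_nonneg_left h3 (Real.sqrt_nonneg _)).trans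
        (mul_le_mul_of_nonneg_right (hc.weight_bounds hm hρ k).2 (abs_nonneg _))
    · rw [← hsplit, add_sub_cancel_left, ← mul_neg, ← Finset.sum_neg_distrib, Finset.mul_sum]
      refine Finset.sum_le_sum fun k hk => ?_
      rw [ColumnModel.off_support k (Finset.mem_filter.1 hk).2 hΔ, mul_neg, mul_neg]
      exact neg_le_neg (mul_le_mul_of_nonneg_right (hc.weight_bounds hm hρ k).1 (abs_nonneg _))
  have hN := norm1_nonneg Δ
  have hNB0 : 0 ≤ NB := Finset.sum_nonneg fun _ _ => abs_nonneg _
  -- `4L³ρ ≤ λ` makes the noise slope `2L²ρ` at most `λ/(2L)`, half of the least penalty slope `λ/L`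
  -- off the support; the other half is what yields the cone.
  have h3 : -(lam / (2 * L) * norm1 Δ) ≤
      2 * lam * (2 * L * NB - 1 / (2 * L) * (norm1 Δ - NB)) := by
    refine le_trans ?_ (h1.trans (mul_le_mul_of_nonneg_left h2 (by linarith)))
    refine neg_le_neg (mul_le_mul_of_nonneg_right ?_ hN)
    rw [le_div_iff₀ (by positivity)]
    linarith
  have h4 : norm1 Δ ≤ (8 * L ^ 2 + 2) * NB := by
    have e : 2 * lam * (2 * L * NB - 1 / (2 * L) * (norm1 Δ - NB)) + lam / (2 * L) * norm1 Δ
        = lam / (2 * L) * ((8 * L ^ 2 + 2) * NB - norm1 Δ) := by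
      field_simp; ring
    have h5 : 0 ≤ lam / (2 * L) * ((8 * L ^ 2 + 2) * NB - norm1 Δ) := by linarith
    have := nonneg_of_mul_nonneg_right h5 (by positivity)
    linarith
  have h5 : norm1 Δ ≤ 10 * L ^ 2 * NB := h4.trans (by gcongr; nlinarith)
  have hcard : (B.card : ℝ) ≤ d := by
    have := hm.supp
    rw [show ({k | k ≠ j ∧ θ k ≠ 0} : Set (Fin p)) = (B : Set (Fin p)) by ext; simp [hB],
      Set.ncard_coe_finset] at this
    exact_mod_cast this
  have h6 : NB ^ 2 ≤ d * ∑ k, Δ k ^ 2 := by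
    refine (sq_sum_le_card_mul_sum_sq).trans ?_
    simp only [sq_abs]
    have h7 : ∑ k ∈ B, Δ k ^ 2 ≤ ∑ k, Δ k ^ 2 :=
      Finset.sum_le_sum_of_subset_of_nonneg (Finset.subset_univ _) fun _ _ _ => sq_nonneg _
    exact mul_le_mul hcard h7 (Finset.sum_nonneg fun _ _ => sq_nonneg _) (Nat.cast_nonneg _)
  calc norm1 Δ ^ 2 ≤ (10 * L ^ 2 * NB) ^ 2 := by gcongr
    _ = 100 * L ^ 4 * NB ^ 2 := by ring
    _ ≤ 100 * L ^ 4 * (d * ∑ k, Δ k ^ 2) := by gcongr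
    _ = _ := by ring

/-- The scale `s` is small enough for the sparsity `d`. -/
structure SmallScale (L A : ℝ) (d : ℕ) (ρ lam s : ℝ) : Prop where
  one_le : 1 ≤ A
  lam_nonneg : 0 ≤ lam
  lam_le : lam ≤ s
  rad_le : ρ ≤ s
  small : d * s * (258 * L ^ 4 * A) ≤ 1

lemma SmallScale.s_nonneg (h : SmallScale L A d ρ lam s) : 0 ≤ s := h.lam_nonneg.trans h.lam_le

lemma SmallScale.rad_le_half (h : SmallScale L A d ρ lam s) (hL : 1 ≤ L) (hd : 1 ≤ d) :
    ρ ≤ 1 / (2 * L) := by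
  refine h.rad_le.trans ?_
  have hs := h.s_nonneg
  have hA := h.one_le
  have hd' : (1 : ℝ) ≤ d := by exact_mod_cast hd
  rw [le_div_iff₀ (by positivity)]
  refine le_trans ?_ h.small
  calc s * (2 * L) = 1 * s * (2 * L * 1) := by ring
    _ ≤ d * s * (258 * L ^ 4 * A) := by
      gcongr
      · norm_num
      · exact le_self_pow₀ hL (by norm_num)

/-- Inserting the bound on `V` into the compatibility inequality gives `N² ≤ c₁N + c₂N²`. Smallness
of `d s` makes `c₂ ≤ 1/2`, so the quadratic term is absorbed and one factor `N` cancels. -/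
lemma rates_aux {L A d s N V : ℝ} (hL : 1 ≤ L) (hs0 : 0 ≤ s) (hA1 : 1 ≤ A) (hd : 1 ≤ d)
    (hN : 0 ≤ N) (hsmall : d * s * (258 * L ^ 4 * A) ≤ 1)
    (hV : V ≤ 18 * L ^ 2 * s * N + 16 * L ^ 2 * s ^ 2 * N ^ 2)
    (hV2 : N ^ 2 ≤ A * d * (L * (V + s * N * N))) :
    N ≤ 36 * L ^ 3 * A * d * s ∧ V ≤ 50 * L ^ 2 * s * N := by
  have hs1 : s ≤ 1 := by
    refine le_trans ?_ hsmall
    calc s = 1 * s * (1 * 1 * 1) := by ring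
      _ ≤ d * s * (258 * L ^ 4 * A) := by
        gcongr
        · norm_num
        · exact one_le_pow₀ hL
  have hkey : A * d * (L * (s + 16 * L ^ 2 * s ^ 2)) ≤ 1 / 2 := by
    have h8 : s + 16 * L ^ 2 * s ^ 2 ≤ 17 * L ^ 2 * s := by
      have : s ≤ L ^ 2 * s := le_mul_of_one_le_left hs0 (one_le_pow₀ hL)
      have : L ^ 2 * s ^ 2 ≤ L ^ 2 * s := by gcongr; nlinarith
      linarith
    calc A * d * (L * (s + 16 * L ^ 2 * s ^ 2)) ≤ A * d * (L * (17 * L ^ 2 * s)) := by gcongr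
      _ = 17 * (d * s * (L ^ 3 * A)) := by ring
      _ ≤ 17 * (d * s * (L ^ 4 * A)) := by gcongr; norm_num
      _ ≤ 1 / 2 := by nlinarith
  have hN1 : N ≤ 36 * L ^ 3 * A * d * s := by
    rcases hN.eq_or_lt with h0 | h0
    · rw [← h0]; positivity
    have h9 : N ^ 2 ≤ A * d * L * (18 * L ^ 2 * s) * N
        + A * d * (L * (s + 16 * L ^ 2 * s ^ 2)) * N ^ 2 := by
      refine hV2.trans ?_
      have h15 : L * (V + s * N * N) ≤
          L * (18 * L ^ 2 * s * N + 16 * L ^ 2 * s ^ 2 * N ^ 2 + s * N * N) :=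
        mul_le_mul_of_nonneg_left (by linarith) (by linarith)
      refine (mul_le_mul_of_nonneg_left h15 (by positivity)).trans (le_of_eq ?_)
      ring
    have h10 : A * d * (L * (s + 16 * L ^ 2 * s ^ 2)) * N ^ 2 ≤ 1 / 2 * N ^ 2 := by gcongr
    have h11 : N * N ≤ 36 * L ^ 3 * A * d * s * N := by nlinarith
    exact le_of_mul_le_mul_right h11 h0
  refine ⟨hN1, hV.trans ?_⟩
  have h12 : s * N ≤ 2 := by
    have : N ≤ 2 := by
      refine hN1.trans ?_
      have h13 : d * s * (L ^ 3 * A) ≤ d * s * (L ^ 4 * A) := by gcongr; norm_num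
      nlinarith
    nlinarith
  have h14 : L ^ 2 * (s * N * (s * N)) ≤ L ^ 2 * (s * N * 2) := by gcongr
  nlinarith

/-- Rates of convergence of the square-root Lasso in `ℓ¹` and prediction norm. -/
lemma CloseAt.rates (hm : ColumnModel L d T θ j) (hc : CloseAt ρ S T θ)
    (hs : SmallScale L A d ρ lam s) (hΔ : Δ j = 0)
    (hmin : Improves S lam ((θ j)⁻¹ • θ) Δ) (hA : norm1 Δ ^ 2 ≤ A * d * ∑ k, Δ k ^ 2) :
    norm1 Δ ≤ 36 * L ^ 3 * A * d * s ∧ bil S Δ Δ ≤ 50 * L ^ 2 * s * norm1 Δ := by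
  have hL := hm.one_le
  have hs0 := hs.s_nonneg
  have hA1 := hs.one_le
  have hd : (1 : ℝ) ≤ d := by exact_mod_cast hm.one_le_deg
  have hρ := hs.rad_le_half hL hm.one_le_deg
  have hN := norm1_nonneg Δ
  have hsmall := hs.small
  have hlam0 := hs.lam_nonneg
  obtain ⟨h1, h2⟩ := hc.target_bounds hm hρ
  obtain ⟨-, h3⟩ := sqrt_bounds hL h1 h2
  have hcross := (abs_le.1 (hc.abs_cross_le hm hΔ)).1
  have hbase := hmin.sqrt_sub_le
  set b₀ := (θ j)⁻¹ • θ
  set x := √(bil S b₀ b₀)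
  set y := √(bil S (b₀ + Δ) (b₀ + Δ))
  have hx : x ^ 2 = bil S b₀ b₀ := Real.sq_sqrt (hc.nonneg _)
  have hy : y ^ 2 = bil S (b₀ + Δ) (b₀ + Δ) := Real.sq_sqrt (hc.nonneg _)
  have hx0 : 0 ≤ x := Real.sqrt_nonneg _
  have hy0 : 0 ≤ y := Real.sqrt_nonneg _
  have hpen : ∑ k, √(S k k) * (|b₀ k| - |(b₀ + Δ) k|) ≤ 2 * L * norm1 Δ := by
    rw [norm1, Finset.mul_sum]
    refine Finset.sum_le_sum fun k _ => ?_
    have h3 : |b₀ k| - |(b₀ + Δ) k| ≤ |Δ k| := by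
      simpa using abs_sub_abs_le_abs_sub (b₀ k) ((b₀ + Δ) k)
    exact (mul_le_mul_of_nonneg_left h3 (Real.sqrt_nonneg _)).trans
      (mul_le_mul_of_nonneg_right (hc.weight_bounds hm hρ k).2 (abs_nonneg _))
  set N := norm1 Δ
  have hyx : y ≤ x + 4 * L * s * N := by
    have : 2 * lam * ∑ k, √(S k k) * (|b₀ k| - |(b₀ + Δ) k|) ≤ 2 * s * (2 * L * N) := by
      refine (mul_le_mul_of_nonneg_left hpen (by linarith)).trans ?_
      have := hs.lam_le
      gcongr
    linarith
  have hcross' : -(L * s * N) ≤ bil S b₀ Δ := by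
    refine le_trans (neg_le_neg ?_) hcross
    have := hs.rad_le
    gcongr
  -- Solve `y² = x² + 2 b₀ᵀSΔ + ΔᵀSΔ` for the last term: `y² - x²` contributes `16L²sN + 16L²s²N²`
  -- and the cross term `2L²sN`.
  have hV : bil S Δ Δ ≤ 18 * L ^ 2 * s * N + 16 * L ^ 2 * s ^ 2 * N ^ 2 := by
    have e := bil_self_add hc.symm b₀ Δ
    rw [← hx, ← hy] at e
    have h5 : y ^ 2 ≤ (x + 4 * L * s * N) ^ 2 := by gcongr
    have h6 : x * (s * N * L) ≤ 2 * L * (s * N * L) := by gcongr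
    have h7 : L * (s * N) ≤ L ^ 2 * (s * N) := by
      gcongr; exact le_self_pow₀ hL (by norm_num)
    nlinarith
  have hent : |bil (S - T) Δ Δ| ≤ s * N * N := by
    refine (abs_bil_le hc.entry Δ Δ).trans ?_
    have := hs.rad_le
    gcongr
  rw [bil_sub_mat] at hent
  have hco := hm.coercive Δ
  have hV2 : N ^ 2 ≤ A * d * (L * (bil S Δ Δ + s * N * N)) := by
    refine hA.trans ?_
    gcongr
    refine hco.trans ?_
    gcongr
    linarith [(abs_le.1 hent).1]
  exact rates_aux hL hs0 hA1 hd hN hsmall hV hV2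

end Deterministic

/-! ### From the regression to a column of the precision matrix -/

section Column

variable {p : ℕ} {L ρ lam s A : ℝ} {d : ℕ} {S T : Matrix (Fin p) (Fin p) ℝ}
  {θ b Δ : Fin p → ℝ} {j : Fin p}

lemma ColumnModel.norm1_le (hm : ColumnModel L d T θ j) : norm1 θ ≤ 2 * L * √(d : ℝ) := by
  classical
  have hL := hm.one_le
  have hd : (1 : ℝ) ≤ d := by exact_mod_cast hm.one_le_deg
  set B := Finset.univ.filter fun k => k ≠ j ∧ θ k ≠ 0 with hB
  have hcard : ((insert j B).card : ℝ) ≤ d + 1 := by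
    have := hm.supp
    rw [show ({k | k ≠ j ∧ θ k ≠ 0} : Set (Fin p)) = (B : Set (Fin p)) by ext; simp [hB],
      Set.ncard_coe_finset] at this
    exact_mod_cast (Finset.card_insert_le _ _).trans (by omega)
  have h1 : norm1 θ = ∑ k ∈ insert j B, |θ k| := by
    refine (Finset.sum_subset (Finset.subset_univ _) fun k _ hk => ?_).symm
    simp only [hB, Finset.mem_insert, Finset.mem_filter, Finset.mem_univ, true_and, not_or,
      not_and, not_not] at hk
    simp [hk.2 hk.1]
  have h2 : norm1 θ ^ 2 ≤ (2 * L * √(d : ℝ)) ^ 2 := by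
    rw [h1]
    refine (sq_sum_le_card_mul_sum_sq).trans ?_
    simp only [sq_abs]
    have h7 : ∑ k ∈ insert j B, θ k ^ 2 ≤ ∑ k, θ k ^ 2 :=
      Finset.sum_le_sum_of_subset_of_nonneg (Finset.subset_univ _) fun _ _ _ => sq_nonneg _
    calc ((insert j B).card : ℝ) * ∑ k ∈ insert j B, θ k ^ 2 ≤ (d + 1) * L ^ 2 :=
          mul_le_mul hcard (h7.trans hm.sq_le) (Finset.sum_nonneg fun _ _ => sq_nonneg _)
            (by positivity)
      _ ≤ 4 * d * L ^ 2 := by gcongr; linarith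
      _ = (2 * L * √(d : ℝ)) ^ 2 := by
        rw [mul_pow, mul_pow, Real.sq_sqrt (by positivity)]; ring
  exact le_of_sq_le_sq h2 (by positivity)

/-- The variance estimate `t` is close to the population value `τ²`, at the rate `√d s`. -/
lemma abs_variance_sub_le_aux {L A r s N V q q₀ e G τ t : ℝ} (hL : 1 ≤ L) (hA : 1 ≤ A)
    (hr : 1 ≤ r) (hs : 0 ≤ s) (hN : 0 ≤ N) (hV0 : 0 ≤ V) (hl0 : 0 ≤ lam) (hl : lam ≤ s)
    (hsmall : r ^ 2 * s * (258 * L ^ 4 * A) ≤ 1)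
    (hN1 : N ≤ 36 * L ^ 3 * A * r ^ 2 * s) (hV : V ≤ 50 * L ^ 2 * s * N)
    (hq : q = q₀ + 2 * e + V) (hq₀ : q₀ ≤ 2 * L) (he : |e| ≤ L * s * N)
    (hG0 : 0 ≤ G) (hG : G ≤ 2 * L ^ 2 * r + N) (hτ : |q₀ - τ| ≤ L ^ 2 * s)
    (ht : t = q + lam * √q * G) : |t - τ| ≤ 129 * L ^ 3 * (r * s) := by
  have hN2 : N ≤ 2 := by
    refine hN1.trans ?_
    have h13 : r ^ 2 * s * (L ^ 3 * A) ≤ r ^ 2 * s * (L ^ 4 * A) := by gcongr; norm_num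
    nlinarith
  have hs1 : s * L ^ 4 ≤ 1 / 258 := by
    have : 1 * (s * L ^ 4 * 1) ≤ r ^ 2 * (s * L ^ 4 * A) := by
      gcongr; exact one_le_pow₀ hr
    nlinarith
  have hL2 : 1 ≤ L ^ 2 := one_le_pow₀ hL
  have hL23 : L ^ 2 ≤ L ^ 3 := pow_le_pow_right₀ hL (by norm_num)
  have hsL2 : s * L ^ 2 ≤ 1 / 258 := by
    refine le_trans ?_ hs1
    gcongr; norm_num
  have hsL : s * L ≤ 1 / 258 := by
    refine le_trans ?_ hsL2
    gcongr; exact le_self_pow₀ hL (by norm_num)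
  have heV : |2 * e + V| ≤ 104 * L ^ 2 * s := by
    have h1 : |2 * e + V| ≤ 2 * (L * s * N) + 50 * L ^ 2 * s * N := by
      rw [abs_le] at he ⊢
      constructor <;> nlinarith
    have h2 : L * (s * N) ≤ L ^ 2 * (s * N) := by
      gcongr; exact le_self_pow₀ hL (by norm_num)
    have h3 : L ^ 2 * s * N ≤ L ^ 2 * s * 2 := by gcongr
    nlinarith
  have hq1 : q ≤ 6 * L := by
    have := (abs_le.1 heV).2
    nlinarith
  have hsq : √q ≤ 6 * L := by
    rw [Real.sqrt_le_left (by linarith)]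
    nlinarith
  have hG2 : G ≤ 4 * L ^ 2 * r := by
    have : 1 ≤ L ^ 2 * r := one_le_mul_of_one_le_of_one_le hL2 hr
    nlinarith
  have h4 : lam * √q * G ≤ 24 * L ^ 3 * (r * s) := by
    calc lam * √q * G ≤ s * (6 * L) * (4 * L ^ 2 * r) := by gcongr
      _ = _ := by ring
  have h5 : 0 ≤ lam * √q * G := by positivity
  have h6 : L ^ 2 * s ≤ L ^ 3 * (r * s) := by
    have : 1 * s ≤ r * s := by gcongr
    calc L ^ 2 * s = L ^ 2 * (1 * s) := by ring
      _ ≤ L ^ 3 * (r * s) := by gcongr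
  -- `129 = 104 + 24 + 1`: fitted variance, penalty term `λ τ̂ ‖γ̂‖₁`, and fluctuation of the
  -- variance at the target. Only the penalty term needs the factor `r = √d`.
  rw [abs_le] at heV hτ ⊢
  constructor <;> nlinarith

lemma CloseAt.variance_estimate (hm : ColumnModel L d T θ j) (hc : CloseAt ρ S T θ)
    (hs : SmallScale L A d ρ lam s) (hΔ : Δ j = 0)
    (hmin : Improves S lam ((θ j)⁻¹ • θ) Δ) (hA : norm1 Δ ^ 2 ≤ A * d * ∑ k, Δ k ^ 2)
    {G t : ℝ} (hG0 : 0 ≤ G) (hG : G ≤ norm1 ((θ j)⁻¹ • θ + Δ))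
    (ht : t = bil S ((θ j)⁻¹ • θ + Δ) ((θ j)⁻¹ • θ + Δ)
      + lam * √(bil S ((θ j)⁻¹ • θ + Δ) ((θ j)⁻¹ • θ + Δ)) * G) :
    |t - (θ j)⁻¹| ≤ 129 * L ^ 3 * (√(d : ℝ) * s) := by
  have hL := hm.one_le
  have hd : (1 : ℝ) ≤ d := by exact_mod_cast hm.one_le_deg
  have hs0 := hs.s_nonneg
  have hρ := hs.rad_le_half hL hm.one_le_deg
  have hd2 : √(d : ℝ) ^ 2 = d := Real.sq_sqrt (by linarith)
  obtain ⟨hN, hV⟩ := hc.rates hm hs hΔ hmin hA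
  have hθ := hm.theta_pos
  refine abs_variance_sub_le_aux hL hs.one_le (Real.one_le_sqrt.2 hd) hs0 (norm1_nonneg Δ)
    (hc.nonneg Δ) hs.lam_nonneg hs.lam_le (by rw [hd2]; exact hs.small) (by rw [hd2]; exact hN) hV
    (bil_self_add hc.symm _ _) (hc.target_bounds hm hρ).2 ?_ hG0 ?_ ?_ ht
  · refine (hc.abs_cross_le hm hΔ).trans ?_
    have := hs.rad_le
    have := norm1_nonneg Δ
    gcongr
  · refine hG.trans ((norm1_add_le _ _).trans ?_)
    gcongr
    rw [norm1_smul, abs_of_pos (by positivity)]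
    calc (θ j)⁻¹ * norm1 θ ≤ L * (2 * L * √(d : ℝ)) :=
          mul_le_mul hm.inv_le hm.norm1_le (norm1_nonneg _) (by linarith)
      _ = _ := by ring
  · refine (hc.abs_target_sub_le hm).trans ?_
    have := hs.rad_le
    gcongr

/-- The error of a column of the nodewise square-root Lasso estimator. -/
lemma CloseAt.column_error (hm : ColumnModel L d T θ j) (hc : CloseAt ρ S T θ)
    (hs : SmallScale L A d ρ lam s) (hΔ : Δ j = 0)
    (hmin : Improves S lam ((θ j)⁻¹ • θ) Δ) (hA : norm1 Δ ^ 2 ≤ A * d * ∑ k, Δ k ^ 2)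
    {G t : ℝ} (hG0 : 0 ≤ G) (hG : G ≤ norm1 ((θ j)⁻¹ • θ + Δ))
    (ht : t = bil S ((θ j)⁻¹ • θ + Δ) ((θ j)⁻¹ • θ + Δ)
      + lam * √(bil S ((θ j)⁻¹ • θ + Δ) ((θ j)⁻¹ • θ + Δ)) * G) :
    norm1 (t⁻¹ • ((θ j)⁻¹ • θ + Δ) - θ) ≤ 600 * L ^ 7 * A * (d * s) ∧
      bil S (t⁻¹ • ((θ j)⁻¹ • θ + Δ) - θ) (t⁻¹ • ((θ j)⁻¹ • θ + Δ) - θ) ≤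
        300000 * L ^ 11 * A * (d * s ^ 2) := by
  have hvar := hc.variance_estimate hm hs hΔ hmin hA hG0 hG ht
  have hL := hm.one_le
  have hA1 := hs.one_le
  have hd : (1 : ℝ) ≤ d := by exact_mod_cast hm.one_le_deg
  have hs0 := hs.s_nonneg
  have hρ := hs.rad_le_half hL hm.one_le_deg
  have hd2 : √(d : ℝ) ^ 2 = d := Real.sq_sqrt (by linarith)
  have hd1 : 1 ≤ √(d : ℝ) := Real.one_le_sqrt.2 hd
  obtain ⟨hN, hV⟩ := hc.rates hm hs hΔ hmin hA
  have hθ := hm.theta_pos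
  have hθL := hm.upper
  have hinvL := hm.inv_le
  have hLinv := hm.le_inv
  have hsmall := hs.small
  have hN0 := norm1_nonneg Δ
  set r := √(d : ℝ)
  have hrs : r * s ≤ d * s := by
    rw [← hd2]; gcongr; exact le_self_pow₀ hd1 (by norm_num)
  -- The constant `258 = 2 · 129` in `SmallScale` is chosen here: it makes the error of `t` at most
  -- half of the lower bound `1/L` of `1/θ_j`.
  have ht1 : 1 / (2 * L) ≤ t := by
    have h1 : 129 * L ^ 3 * (r * s) ≤ 1 / (2 * L) := by
      rw [le_div_iff₀ (by positivity)]
      calc 129 * L ^ 3 * (r * s) * (2 * L) = r * s * (258 * L ^ 4 * 1) := by ring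
        _ ≤ d * s * (258 * L ^ 4 * A) := by gcongr
        _ ≤ 1 := hsmall
    have e : 1 / (2 * L) = (1 / L) / 2 := by field_simp
    have := (abs_le.1 hvar).1
    linarith
  have ht0 : 0 < t := lt_of_lt_of_le (by positivity) ht1
  have htinv : t⁻¹ ≤ 2 * L := by
    rw [inv_le_comm₀ ht0 (by positivity), ← one_div]; exact ht1
  have hwabs : |t⁻¹ - θ j| ≤ 258 * L ^ 5 * (r * s) := by
    have e : t⁻¹ - θ j = -(t⁻¹ * θ j * (t - (θ j)⁻¹)) := by field_simp; ring
    rw [e, abs_neg, abs_mul, abs_of_pos (by positivity)]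
    calc t⁻¹ * θ j * |t - (θ j)⁻¹| ≤ (2 * L) * L * (129 * L ^ 3 * (r * s)) := by gcongr
      _ = _ := by ring
  -- Separates the error of the coefficients from that of the scale. The latter is of order `√d s`;
  -- it meets `‖b₀‖₁ ≲ √d` in the `ℓ¹` bound and is squared in the quadratic form.
  have hdec : t⁻¹ • ((θ j)⁻¹ • θ + Δ) - θ = t⁻¹ • Δ + (t⁻¹ - θ j) • ((θ j)⁻¹ • θ) := by
    ext k
    simp only [Pi.sub_apply, Pi.smul_apply, Pi.add_apply, smul_eq_mul]
    field_simp
    ring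
  have hb1 : norm1 ((θ j)⁻¹ • θ) ≤ 2 * L ^ 2 * r := by
    rw [norm1_smul, abs_of_pos (by positivity)]
    calc (θ j)⁻¹ * norm1 θ ≤ L * (2 * L * r) :=
          mul_le_mul hinvL hm.norm1_le (norm1_nonneg _) (by linarith)
      _ = _ := by ring
  rw [hdec]
  constructor
  · refine (norm1_add_le _ _).trans ?_
    rw [norm1_smul, norm1_smul _ ((θ j)⁻¹ • θ), abs_of_pos (by positivity)]
    calc t⁻¹ * norm1 Δ + |t⁻¹ - θ j| * norm1 ((θ j)⁻¹ • θ)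
        ≤ 2 * L * (36 * L ^ 3 * A * d * s) + 258 * L ^ 5 * (r * s) * (2 * L ^ 2 * r) := by
          have := norm1_nonneg ((θ j)⁻¹ • θ)
          gcongr
      _ = 72 * L ^ 4 * A * (d * s) + 516 * L ^ 7 * 1 * (r ^ 2 * s) := by ring
      _ = 72 * L ^ 4 * A * (d * s) + 516 * L ^ 7 * 1 * (d * s) := by rw [hd2]
      _ ≤ 72 * L ^ 7 * A * (d * s) + 516 * L ^ 7 * A * (d * s) := by
        gcongr
        norm_num
      _ ≤ _ := by
        have : 0 ≤ L ^ 7 * A * (d * s) := by positivity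
        linarith
  · refine (bil_self_add_le hc.symm hc.nonneg _ _).trans ?_
    rw [bil_smul_left, bil_smul_right, bil_smul_left _ (t⁻¹ - θ j), bil_smul_right _ (t⁻¹ - θ j)]
    have hV' : bil S Δ Δ ≤ 1800 * L ^ 5 * A * (d * s ^ 2) := by
      calc bil S Δ Δ ≤ 50 * L ^ 2 * s * norm1 Δ := hV
        _ ≤ 50 * L ^ 2 * s * (36 * L ^ 3 * A * d * s) := by gcongr
        _ = _ := by ring
    have h1 : t⁻¹ * (t⁻¹ * bil S Δ Δ) ≤ 2 * L * (2 * L * (1800 * L ^ 5 * A * (d * s ^ 2))) := by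
      have := hc.nonneg Δ
      gcongr
    have hq := (hc.target_bounds hm hρ).2
    have hq0 := hc.nonneg ((θ j)⁻¹ • θ)
    have h2 : (t⁻¹ - θ j) * ((t⁻¹ - θ j) * bil S ((θ j)⁻¹ • θ) ((θ j)⁻¹ • θ)) ≤
        (258 * L ^ 5 * (r * s)) ^ 2 * (2 * L) := by
      rw [← mul_assoc, ← sq, ← sq_abs]
      gcongr
    calc 2 * (t⁻¹ * (t⁻¹ * bil S Δ Δ))
          + 2 * ((t⁻¹ - θ j) * ((t⁻¹ - θ j) * bil S ((θ j)⁻¹ • θ) ((θ j)⁻¹ • θ)))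
        ≤ 2 * (2 * L * (2 * L * (1800 * L ^ 5 * A * (d * s ^ 2))))
          + 2 * ((258 * L ^ 5 * (r * s)) ^ 2 * (2 * L)) := by gcongr
      _ = 14400 * L ^ 7 * A * (d * s ^ 2) + 266256 * L ^ 11 * 1 * (r ^ 2 * s ^ 2) := by ring
      _ = 14400 * L ^ 7 * A * (d * s ^ 2) + 266256 * L ^ 11 * 1 * (d * s ^ 2) := by rw [hd2]
      _ ≤ 14400 * L ^ 11 * A * (d * s ^ 2) + 266256 * L ^ 11 * A * (d * s ^ 2) := by
        gcongr
        norm_num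
      _ ≤ _ := by
        have : 0 ≤ L ^ 11 * A * (d * s ^ 2) := by positivity
        linarith

end Column

/-! ### Matrix form of the estimator and its deterministic remainder bound -/

section Estimator

variable {n p : ℕ}

/-- The coefficient vector `(1, -γ)` of a nodewise regression. -/
def coefVec (j : Fin p) (γ : {k : Fin p // k ≠ j} → ℝ) : Fin p → ℝ :=
  fun k => if h : k = j then 1 else -γ ⟨k, h⟩

lemma coefVec_self (j : Fin p) (γ : {k : Fin p // k ≠ j} → ℝ) : coefVec j γ j = 1 := by
  simp [coefVec]

lemma coefVec_subtype (j : Fin p) (γ : {k : Fin p // k ≠ j} → ℝ) (k : {k : Fin p // k ≠ j}) :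
    coefVec j γ k = -γ k := by
  simp [coefVec, k.2]

lemma sum_eq_add_sum_subtype_ne (j : Fin p) (f : Fin p → ℝ) :
    ∑ k, f k = f j + ∑ k : {k : Fin p // k ≠ j}, f k := by
  rw [← Finset.add_sum_erase _ _ (Finset.mem_univ j)]
  congr 1
  exact Finset.sum_subtype _ (by simp) f

lemma residual_eq (X : Matrix (Fin n) (Fin p) ℝ) (j : Fin p) (γ : {k : Fin p // k ≠ j} → ℝ) :
    residual X j γ = X *ᵥ coefVec j γ := by
  ext i
  change _ = ∑ k, X i k * coefVec j γ k
  rw [sum_eq_add_sum_subtype_ne j, coefVec_self]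
  simp only [coefVec_subtype, mul_neg, Finset.sum_neg_distrib, residual]
  ring

lemma bil_sampleCov (X : Matrix (Fin n) (Fin p) ℝ) (x y : Fin p → ℝ) :
    bil (sampleCov X) x y = 1 / (n : ℝ) * ∑ i, (X *ᵥ x) i * (X *ᵥ y) i := by
  unfold bil sampleCov
  rw [Matrix.smul_mulVec, dotProduct_smul, smul_eq_mul, ← Matrix.mulVec_mulVec,
    Matrix.dotProduct_mulVec, Matrix.vecMul_transpose]
  rfl

lemma sampleCov_isSymm (X : Matrix (Fin n) (Fin p) ℝ) : (sampleCov X).IsSymm := by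
  unfold Matrix.IsSymm sampleCov
  rw [Matrix.transpose_smul, Matrix.transpose_mul, Matrix.transpose_transpose]

lemma bil_sampleCov_nonneg (X : Matrix (Fin n) (Fin p) ℝ) (x : Fin p → ℝ) :
    0 ≤ bil (sampleCov X) x x := by
  rw [bil_sampleCov]
  exact mul_nonneg (by positivity) (Finset.sum_nonneg fun i _ => mul_self_nonneg _)

lemma noiseLevel_eq (X : Matrix (Fin n) (Fin p) ℝ) (j : Fin p) (γ : {k : Fin p // k ≠ j} → ℝ) :
    noiseLevel X j γ = √(bil (sampleCov X) (coefVec j γ) (coefVec j γ)) := by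
  unfold noiseLevel
  rw [← Real.sqrt_div (Finset.sum_nonneg fun _ _ => sq_nonneg _), bil_sampleCov, residual_eq]
  congr 1
  simp only [sq]
  ring

/-- Penalising all coordinates of `(1, -γ)` adds a quantity independent of `γ`, so the minimiser can
be studied as a vector indexed by all of `Fin p`. -/
lemma objective_eq (X : Matrix (Fin n) (Fin p) ℝ) (lam : ℝ) (j : Fin p)
    (γ : {k : Fin p // k ≠ j} → ℝ) :
    objective X lam j γ = √(bil (sampleCov X) (coefVec j γ) (coefVec j γ))
      + 2 * lam * ∑ k, √(sampleCov X k k) * |coefVec j γ k| - 2 * lam * √(sampleCov X j j) := by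
  unfold objective
  rw [noiseLevel_eq, sum_eq_add_sum_subtype_ne j, coefVec_self]
  simp only [coefVec_subtype, abs_neg, abs_mul, weight, abs_of_nonneg (Real.sqrt_nonneg _)]
  simp
  ring

lemma nodewise_col (X : Matrix (Fin n) (Fin p) ℝ) (lam : ℝ)
    (γ : (j : Fin p) → {k : Fin p // k ≠ j} → ℝ) (j : Fin p) :
    (fun k => nodewise X lam γ k j) = (tauTildeSq X lam j (γ j))⁻¹ • coefVec j (γ j) := by
  ext k
  simp only [nodewise, Matrix.of_apply, coefVec, Pi.smul_apply, smul_eq_mul]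
  split_ifs <;> ring

/-- The terms linear in the estimation error cancel because `Θ` inverts `T`; this is the purpose of
the de-biasing. -/
lemma debiased_sub_eq (X : Matrix (Fin n) (Fin p) ℝ) (lam : ℝ)
    (γ : (j : Fin p) → {k : Fin p // k ≠ j} → ℝ) {Θ T : Matrix (Fin p) (Fin p) ℝ}
    (h1 : Θ * T = 1) (h2 : T * Θ = 1) :
    debiased X lam γ - Θ + Θ * (sampleCov X - T) * Θ =
      -((nodewise X lam γ - Θᵀ)ᵀ * (sampleCov X - T) * Θ)
      - Θ * (sampleCov X - T) * (nodewise X lam γ - Θ)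
      - (nodewise X lam γ - Θᵀ)ᵀ * sampleCov X * (nodewise X lam γ - Θ) := by
  unfold debiased
  rw [Matrix.transpose_sub, Matrix.transpose_transpose]
  set N := nodewise X lam γ
  set S := sampleCov X
  have e1 : Nᵀ * T * Θ = Nᵀ := by rw [Matrix.mul_assoc, h2, Matrix.mul_one]
  have e2 : Θ * T * N = N := by rw [h1, Matrix.one_mul]
  have e3 : Θ * T * Θ = Θ := by rw [h1, Matrix.one_mul]
  simp only [Matrix.sub_mul, Matrix.mul_sub, e1, e2, e3]
  abel

lemma tauTildeSq_eq (X : Matrix (Fin n) (Fin p) ℝ) (lam : ℝ) (j : Fin p)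
    (γ : {k : Fin p // k ≠ j} → ℝ) :
    tauTildeSq X lam j γ = bil (sampleCov X) (coefVec j γ) (coefVec j γ)
      + lam * √(bil (sampleCov X) (coefVec j γ) (coefVec j γ)) * ∑ k, |γ k| := by
  unfold tauTildeSq
  rw [noiseLevel_eq, Real.sq_sqrt (bil_sampleCov_nonneg _ _)]

lemma IsSqrtLasso.improves {X : Matrix (Fin n) (Fin p) ℝ} {lam : ℝ} {j : Fin p}
    {γ : {k : Fin p // k ≠ j} → ℝ} (h : IsSqrtLasso X lam j γ) {b : Fin p → ℝ} (hb : b j = 1) :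
    Improves (sampleCov X) lam b (coefVec j γ - b) := by
  have h1 := h fun k => -b k
  have h2 : coefVec j (fun k : {k : Fin p // k ≠ j} => -b k) = b := by
    ext k
    unfold coefVec
    split_ifs with hk
    · rw [hk, hb]
    · simp
  rw [objective_eq, objective_eq, h2] at h1
  unfold Improves
  rw [add_sub_cancel]
  linarith

/-- The deterministic bound for a column of the estimator. -/
lemma nodewise_col_error {X : Matrix (Fin n) (Fin p) ℝ} {lam L ρ s A : ℝ} {d : ℕ}
    {T : Matrix (Fin p) (Fin p) ℝ} {θ : Fin p → ℝ} {j : Fin p}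
    {γ : (j : Fin p) → {k : Fin p // k ≠ j} → ℝ}
    (hm : ColumnModel L d T θ j) (hc : CloseAt ρ (sampleCov X) T θ)
    (hs : SmallScale L A d ρ lam s) (hγ : IsSqrtLasso X lam j (γ j))
    (hA : (0 < lam ∧ 4 * L ^ 3 * ρ ≤ lam ∧ 100 * L ^ 4 ≤ A) ∨ (p : ℝ) ≤ A) :
    norm1 ((fun k => nodewise X lam γ k j) - θ) ≤ 600 * L ^ 7 * A * (d * s) ∧
      bil (sampleCov X) ((fun k => nodewise X lam γ k j) - θ)
        ((fun k => nodewise X lam γ k j) - θ) ≤ 300000 * L ^ 11 * A * (d * s ^ 2) := by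
  have hθ := hm.theta_pos
  have hb : ((θ j)⁻¹ • θ) j = 1 := by simp [hθ.ne']
  have hmin := hγ.improves hb
  have hΔ : (coefVec j (γ j) - (θ j)⁻¹ • θ) j = 0 := by
    rw [Pi.sub_apply, coefVec_self, hb, sub_self]
  have hcomp : norm1 (coefVec j (γ j) - (θ j)⁻¹ • θ) ^ 2 ≤
      A * d * ∑ k, (coefVec j (γ j) - (θ j)⁻¹ • θ) k ^ 2 := by
    have hQ : 0 ≤ ∑ k, (coefVec j (γ j) - (θ j)⁻¹ • θ) k ^ 2 :=
      Finset.sum_nonneg fun _ _ => sq_nonneg _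
    have hd : (1 : ℝ) ≤ d := by exact_mod_cast hm.one_le_deg
    -- Either `λ` dominates the noise and the cone condition holds, or `A` exceeds the dimension and
    -- Cauchy-Schwarz over all coordinates suffices, without relating `λ` to `ρ`.
    rcases hA with ⟨h1, h2, h3⟩ | h
    · refine (hc.cone hm (hs.rad_le_half hm.one_le hm.one_le_deg) h1 h2 hΔ hmin).trans ?_
      gcongr
    · refine (sq_sum_le_card_mul_sum_sq).trans ?_
      simp only [sq_abs, Finset.card_univ, Fintype.card_fin]
      refine mul_le_mul_of_nonneg_right ?_ hQ
      have := hs.one_le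
      nlinarith
  have hadd : (θ j)⁻¹ • θ + (coefVec j (γ j) - (θ j)⁻¹ • θ) = coefVec j (γ j) := add_sub_cancel _ _
  have hG : ∑ k, |γ j k| ≤ norm1 ((θ j)⁻¹ • θ + (coefVec j (γ j) - (θ j)⁻¹ • θ)) := by
    rw [hadd, norm1, sum_eq_add_sum_subtype_ne j]
    simp only [coefVec_subtype, abs_neg]
    linarith [abs_nonneg (coefVec j (γ j) j)]
  have := hc.column_error hm hs hΔ hmin hcomp (Finset.sum_nonneg fun _ _ => abs_nonneg _) hG
    (t := tauTildeSq X lam j (γ j)) (by rw [hadd]; exact tauTildeSq_eq X lam j (γ j))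
  rwa [hadd, ← nodewise_col] at this

lemma mul_mul_apply_eq_bil (A B C : Matrix (Fin p) (Fin p) ℝ) (i j : Fin p) :
    (Aᵀ * B * C) i j = bil B (fun k => A k i) (fun k => C k j) := by
  rw [Matrix.mul_assoc]
  rfl

/-- The deterministic bound for the remainder of the de-biased estimator. -/
lemma supNorm_remainder_le {X : Matrix (Fin n) (Fin p) ℝ} {lam L ρ s A : ℝ} {d : ℕ}
    {T Θ : Matrix (Fin p) (Fin p) ℝ} {γ : (j : Fin p) → {k : Fin p // k ≠ j} → ℝ}
    (h1 : Θ * T = 1) (h2 : T * Θ = 1) (hΘ : Θᵀ = Θ) (hp : 0 < p)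
    (hm : ∀ j, ColumnModel L d T (fun k => Θ k j) j)
    (hc : ∀ j, CloseAt ρ (sampleCov X) T (fun k => Θ k j))
    (hs : SmallScale L A d ρ lam s) (hγ : ∀ j, IsSqrtLasso X lam j (γ j))
    (hA : (0 < lam ∧ 4 * L ^ 3 * ρ ≤ lam ∧ 100 * L ^ 4 ≤ A) ∨ (p : ℝ) ≤ A) :
    supNorm (debiased X lam γ - Θ + Θ * (sampleCov X - T) * Θ) ≤
      301200 * L ^ 11 * A * (d * s ^ 2) := by
  have : Nonempty (Fin p × Fin p) := ⟨⟨0, hp⟩, ⟨0, hp⟩⟩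
  refine ciSup_le fun ⟨i, j⟩ => ?_
  have hL := (hm i).one_le
  have hs0 := hs.s_nonneg
  have hA1 := hs.one_le
  set S := sampleCov X
  set D : Fin p → Fin p → ℝ := fun j => (fun k => nodewise X lam γ k j) - fun k => Θ k j with hD
  have hcol : ∀ j, norm1 (D j) ≤ 600 * L ^ 7 * A * (d * s) ∧
      bil S (D j) (D j) ≤ 300000 * L ^ 11 * A * (d * s ^ 2) := fun j =>
    nodewise_col_error (hm j) (hc j) hs (hγ j) hA
  have hsymm : (S - T).IsSymm := by
    have hT : Tᵀ = T := by
      have h3 : Tᵀ * Θ = 1 := by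
        conv_lhs => rw [← hΘ]
        rw [← Matrix.transpose_mul, h1, Matrix.transpose_one]
      calc Tᵀ = Tᵀ * (Θ * T) := by rw [h1, Matrix.mul_one]
        _ = T := by rw [← Matrix.mul_assoc, h3, Matrix.one_mul]
    unfold Matrix.IsSymm
    rw [Matrix.transpose_sub, hT, (sampleCov_isSymm X).eq]
  have hent : (debiased X lam γ - Θ + Θ * (S - T) * Θ) i j =
      -bil (S - T) (D i) (fun k => Θ k j) - bil (S - T) (fun k => Θ k i) (D j)
        - bil S (D i) (D j) := by
    rw [debiased_sub_eq X lam γ h1 h2, hΘ, Matrix.sub_apply, Matrix.sub_apply, Matrix.neg_apply,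
      mul_mul_apply_eq_bil, mul_mul_apply_eq_bil]
    rw [show Θ * (S - T) * (nodewise X lam γ - Θ) = Θᵀ * (S - T) * (nodewise X lam γ - Θ) by
      rw [hΘ], mul_mul_apply_eq_bil]
    rfl
  have hcross : ∀ i j, |bil (S - T) (D i) (fun k => Θ k j)| ≤ 600 * L ^ 11 * A * (d * s ^ 2) := by
    intro i j
    calc |bil (S - T) (D i) (fun k => Θ k j)| ≤ ρ * norm1 (D i) :=
          abs_dotProduct_le fun k => Or.inr ((hc j).col k)
      _ ≤ s * (600 * L ^ 7 * A * (d * s)) :=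
          mul_le_mul hs.rad_le (hcol i).1 (norm1_nonneg _) hs0
      _ = 600 * L ^ 7 * A * (d * s ^ 2) := by ring
      _ ≤ 600 * L ^ 11 * A * (d * s ^ 2) := by
        gcongr
        norm_num
  have hquad : |bil S (D i) (D j)| ≤ 300000 * L ^ 11 * A * (d * s ^ 2) := by
    refine abs_le_of_sq_le_sq ?_ (by positivity)
    refine (bil_sq_le (sampleCov_isSymm X) (bil_sampleCov_nonneg X) _ _).trans ?_
    rw [sq]
    exact mul_le_mul (hcol i).2 (hcol j).2 (bil_sampleCov_nonneg X _) (by positivity)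
  have e1 := abs_le.1 (hcross i j)
  have e2 := abs_le.1 (hcross j i)
  rw [bil_comm hsymm] at e2
  have e3 := abs_le.1 hquad
  simp only
  rw [hent, abs_le]
  constructor <;> linarith [e1.1, e1.2, e2.1, e2.2, e3.1, e3.2]

end Estimator

/-! ### Spectral bounds for the population matrices -/

section Population

variable {p : ℕ}

open MatrixOrder in
-- For a Hermitian matrix, a lower bound on the spectrum is a bound in the Loewner order.
lemma le_bil_of_le_spectrum {A : Matrix (Fin p) (Fin p) ℝ} (hA : A.IsSymm) {r : ℝ}
    (h : ∀ x ∈ spectrum ℝ A, r ≤ x) (x : Fin p → ℝ) : r * ∑ k, x k ^ 2 ≤ bil A x x := by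
  have hH : A.IsHermitian := by
    unfold Matrix.IsHermitian
    rw [Matrix.conjTranspose_eq_transpose_of_trivial, hA.eq]
  have h1 : algebraMap ℝ (Matrix (Fin p) (Fin p) ℝ) r ≤ A :=
    (algebraMap_le_iff_le_spectrum hH).2 h
  have h2 := (Matrix.le_iff.1 h1).dotProduct_mulVec_nonneg x
  rw [Matrix.sub_mulVec, dotProduct_sub, Algebra.algebraMap_eq_smul_one, Matrix.smul_mulVec,
    Matrix.one_mulVec, dotProduct_smul, star_trivial, smul_eq_mul] at h2
  have h3 : x ⬝ᵥ x = ∑ k, x k ^ 2 := Finset.sum_congr rfl fun k _ => (sq _).symm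
  rw [h3] at h2
  exact sub_nonneg.1 h2

lemma bil_neg_mat (A : Matrix (Fin p) (Fin p) ℝ) (x y : Fin p → ℝ) :
    bil (-A) x y = -bil A x y := by
  simp [bil, Matrix.neg_mulVec]

lemma bil_le_of_spectrum_le {A : Matrix (Fin p) (Fin p) ℝ} (hA : A.IsSymm) {r : ℝ}
    (h : ∀ x ∈ spectrum ℝ A, x ≤ r) (x : Fin p → ℝ) : bil A x x ≤ r * ∑ k, x k ^ 2 := by
  have h1 := le_bil_of_le_spectrum (A := -A) (r := -r) (by simpa using hA.neg)
    (fun y hy => by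
      rw [← spectrum.neg_eq, Set.mem_neg] at hy
      linarith [h _ hy]) x
  rw [bil_neg_mat] at h1
  linarith

lemma popCov_isSymm (P : Measure (Fin p → ℝ)) : (popCov P).IsSymm := by
  ext j k
  simp [popCov, covariance_comm]

lemma precision_isSymm (P : Measure (Fin p → ℝ)) : (precision P).IsSymm := by
  unfold Matrix.IsSymm precision
  rw [Matrix.transpose_nonsing_inv, (popCov_isSymm P).eq]

lemma sum_single_sq (j : Fin p) : ∑ k, (Pi.single j 1 : Fin p → ℝ) k ^ 2 = 1 := by
  simp [Pi.single_apply]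

variable {L : ℝ} {P : Measure (Fin p → ℝ)}

lemma BoundedSpectrum.precision_mul (h : BoundedSpectrum L P) : precision P * popCov P = 1 :=
  Matrix.nonsing_inv_mul _ ((Matrix.isUnit_iff_isUnit_det _).1 h.1)

lemma BoundedSpectrum.mul_precision (h : BoundedSpectrum L P) : popCov P * precision P = 1 :=
  Matrix.mul_nonsing_inv _ ((Matrix.isUnit_iff_isUnit_det _).1 h.1)

/-- Expand the nonnegative form `zᵀΘz` at `z = Tx - x/L` and use `xᵀΘx ≤ L‖x‖²`. This bounds `T`
from below without discussing its spectrum. -/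
lemma BoundedSpectrum.coercive (h : BoundedSpectrum L P) (hL : 1 ≤ L) (x : Fin p → ℝ) :
    ∑ k, x k ^ 2 ≤ L * bil (popCov P) x x := by
  have hup := bil_le_of_spectrum_le (precision_isSymm P) (fun μ hμ => (h.2 μ hμ).2) x
  have hlow := le_bil_of_le_spectrum (precision_isSymm P) (fun μ hμ => (h.2 μ hμ).1)
    (popCov P *ᵥ x + (-(1 / L)) • x)
  have h0 : 0 ≤ ∑ k, (popCov P *ᵥ x + (-(1 / L)) • x) k ^ 2 :=
    Finset.sum_nonneg fun _ _ => sq_nonneg _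
  have h1 : bil (precision P) (popCov P *ᵥ x) (popCov P *ᵥ x) = bil (popCov P) x x := by
    unfold bil
    rw [Matrix.mulVec_mulVec, h.precision_mul, Matrix.one_mulVec, dotProduct_comm]
  have h2 : bil (precision P) (popCov P *ᵥ x) x = ∑ k, x k ^ 2 := by
    rw [bil_comm (precision_isSymm P)]
    unfold bil
    rw [Matrix.mulVec_mulVec, h.precision_mul, Matrix.one_mulVec]
    exact Finset.sum_congr rfl fun k _ => (sq _).symm
  rw [bil_self_add (precision_isSymm P), h1, bil_smul_right, h2, bil_smul_left,
    bil_smul_right] at hlow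
  have h3 : 0 ≤ 1 / L * ∑ k, (popCov P *ᵥ x + (-(1 / L)) • x) k ^ 2 := by positivity
  have h4 : -(1 / L) * (-(1 / L) * bil (precision P) x x) ≤ 1 / L * ∑ k, x k ^ 2 := by
    calc -(1 / L) * (-(1 / L) * bil (precision P) x x)
        = 1 / L * (1 / L) * bil (precision P) x x := by ring
      _ ≤ 1 / L * (1 / L) * (L * ∑ k, x k ^ 2) := by gcongr
      _ = _ := by field_simp
  have h5 : 1 / L * ∑ k, x k ^ 2 ≤ bil (popCov P) x x := by linarith
  rw [one_div, inv_mul_le_iff₀ (by linarith)] at h5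
  exact h5

/-- The lower spectral bound of `Θ` at `Tx` reads `‖Tx‖² ≤ L xᵀTx`; combine it with `‖Tx - Lx‖² ≥
0`. -/
lemma BoundedSpectrum.popCov_le (h : BoundedSpectrum L P) (hL : 1 ≤ L) (x : Fin p → ℝ) :
    bil (popCov P) x x ≤ L * ∑ k, x k ^ 2 := by
  have hlow := le_bil_of_le_spectrum (precision_isSymm P) (fun μ hμ => (h.2 μ hμ).1)
    (popCov P *ᵥ x)
  have h1 : bil (precision P) (popCov P *ᵥ x) (popCov P *ᵥ x) = bil (popCov P) x x := by
    unfold bil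
    rw [Matrix.mulVec_mulVec, h.precision_mul, Matrix.one_mulVec, dotProduct_comm]
  rw [h1] at hlow
  have h2 : 0 ≤ ∑ k, ((popCov P *ᵥ x) k - L * x k) ^ 2 := Finset.sum_nonneg fun _ _ => sq_nonneg _
  have h3 : ∑ k, ((popCov P *ᵥ x) k - L * x k) ^ 2 = ∑ k, (popCov P *ᵥ x) k ^ 2
      - 2 * L * bil (popCov P) x x + L ^ 2 * ∑ k, x k ^ 2 := by
    unfold bil dotProduct
    rw [Finset.mul_sum, Finset.mul_sum, ← Finset.sum_sub_distrib, ← Finset.sum_add_distrib]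
    exact Finset.sum_congr rfl fun k _ => by ring
  rw [one_div, inv_mul_le_iff₀ (by linarith)] at hlow
  have h4 : L * bil (popCov P) x x ≤ L * (L * ∑ k, x k ^ 2) := by nlinarith
  exact le_of_mul_le_mul_left h4 (by linarith)

lemma BoundedSpectrum.popCov_mulVec_col (h : BoundedSpectrum L P) (j : Fin p) :
    popCov P *ᵥ (fun k => precision P k j) = Pi.single j 1 := by
  have : (fun k => precision P k j) = precision P *ᵥ Pi.single j 1 := by
    ext k; simp
  rw [this, Matrix.mulVec_mulVec, h.mul_precision, Matrix.one_mulVec]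

lemma BoundedSpectrum.precision_diag (h : BoundedSpectrum L P) (j : Fin p) :
    1 / L ≤ precision P j j ∧ precision P j j ≤ L := by
  have h1 := bil_le_of_spectrum_le (precision_isSymm P) (fun μ hμ => (h.2 μ hμ).2) (Pi.single j 1)
  have h2 := le_bil_of_le_spectrum (precision_isSymm P) (fun μ hμ => (h.2 μ hμ).1) (Pi.single j 1)
  rw [bil_single_single, sum_single_sq, mul_one] at h1 h2
  exact ⟨h2, h1⟩

lemma BoundedSpectrum.sum_col_sq_le (h : BoundedSpectrum L P) (hL : 1 ≤ L) (j : Fin p) :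
    ∑ k, precision P k j ^ 2 ≤ L ^ 2 := by
  refine (h.coercive hL fun k => precision P k j).trans ?_
  unfold bil
  rw [h.popCov_mulVec_col]
  simp only [dotProduct_single, mul_one]
  nlinarith [(h.precision_diag j).2]

lemma BoundedSpectrum.columnModel (h : BoundedSpectrum L P) (hL : 1 ≤ L) (j : Fin p) :
    ColumnModel L (sparsity P) (popCov P) (fun k => precision P k j) j where
  one_le := hL
  one_le_deg := le_max_left _ _
  coercive := h.coercive hL
  solve := h.popCov_mulVec_col j
  lower := (h.precision_diag j).1
  upper := (h.precision_diag j).2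
  sq_le := h.sum_col_sq_le hL j
  supp := (Finset.le_sup (f := fun j => Set.ncard {i | i ≠ j ∧ precision P i j ≠ 0})
    (Finset.mem_univ j)).trans (le_max_right _ _)
  diag_lower k := by
    have := h.coercive hL (Pi.single k 1)
    rw [bil_single_single, sum_single_sq] at this
    rw [div_le_iff₀ (by linarith)]
    linarith
  diag_upper k := by
    have := h.popCov_le hL (Pi.single k 1)
    rwa [bil_single_single, sum_single_sq, mul_one] at this

/-- The coordinate vectors and the columns of a matrix. -/
def testVec (Θ : Matrix (Fin p) (Fin p) ℝ) : Fin p ⊕ Fin p → Fin p → ℝ :=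
  Sum.elim (fun k => Pi.single k 1) (fun j k => Θ k j)

lemma BoundedSpectrum.testVec_sq_le (h : BoundedSpectrum L P) (hL : 1 ≤ L) (a : Fin p ⊕ Fin p) :
    ∑ k, testVec (precision P) a k ^ 2 ≤ L ^ 2 := by
  rcases a with k | j
  · simp only [testVec, Sum.elim_inl, sum_single_sq]
    exact one_le_pow₀ hL
  · exact h.sum_col_sq_le hL j

lemma closeAt_of_testVec {n : ℕ} {ρ : ℝ} {X : Matrix (Fin n) (Fin p) ℝ}
    {T Θ : Matrix (Fin p) (Fin p) ℝ}
    (h : ∀ a b, |bil (sampleCov X - T) (testVec Θ a) (testVec Θ b)| ≤ ρ) (j : Fin p) :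
    CloseAt ρ (sampleCov X) T (fun k => Θ k j) where
  symm := sampleCov_isSymm X
  nonneg := bil_sampleCov_nonneg X
  entry i k := by
    have := h (Sum.inl i) (Sum.inl k)
    simpa only [testVec, Sum.elim_inl, bil_single_single] using this
  col k := by
    have := h (Sum.inl k) (Sum.inr j)
    simpa only [testVec, Sum.elim_inl, Sum.elim_inr, bil_single_left] using this
  quad := h (Sum.inr j) (Sum.inr j)

end Population

/-! ### Sub-exponential variables and a Bernstein inequality -/

section CenteredExp

/-- A centred law on the line with a bound on an exponential moment. -/
structure CenteredExp (ν : Measure ℝ) : Prop where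
  integrable_exp_abs : Integrable (fun x => Real.exp |x|) ν
  integral_exp_abs_le : ∫ x, Real.exp |x| ∂ν ≤ 6
  mean_eq_zero : ∫ x, x ∂ν = 0

/-- Half of the exponential pays for the power; the other half absorbs `exp |s x|` for `|s| ≤ 1/2`
in the Taylor remainders below. -/
lemma abs_pow_le_factorial_mul_exp (x : ℝ) (k : ℕ) :
    |x| ^ k ≤ 2 ^ k * k.factorial * Real.exp (|x| / 2) := by
  have h := Real.pow_div_factorial_le_exp (|x| / 2) (by positivity) k
  rw [div_le_iff₀ (by positivity), div_pow, div_le_iff₀ (by positivity)] at h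
  linarith

lemma exp_le_quadratic (x : ℝ) : Real.exp x ≤ 1 + x + x ^ 2 * Real.exp |x| := by
  have h := Complex.norm_exp_sub_sum_le_norm_mul_exp (x : ℂ) 2
  simp only [Finset.sum_range_succ, Finset.sum_range_zero, pow_zero, pow_one, Nat.factorial,
    zero_add, Nat.cast_one, div_one, mul_one] at h
  rw [← Complex.ofReal_exp, ← Complex.ofReal_one, ← Complex.ofReal_add, ← Complex.ofReal_sub,
    Complex.norm_real, Complex.norm_real, Real.norm_eq_abs, Real.norm_eq_abs, sq_abs] at h
  linarith [le_abs_self (Real.exp x - (1 + x))]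

lemma exp_mul_le_of_abs_le_half {s : ℝ} (hs : |s| ≤ 1 / 2) (x : ℝ) :
    Real.exp (s * x) ≤ 1 + s * x + 8 * s ^ 2 * Real.exp |x| := by
  refine (exp_le_quadratic _).trans ?_
  have h1 : |s * x| ≤ |x| / 2 := by
    rw [abs_mul]; nlinarith [abs_nonneg x]
  have h2 : x ^ 2 ≤ 8 * Real.exp (|x| / 2) := by
    have := abs_pow_le_factorial_mul_exp x 2
    rw [sq_abs] at this
    norm_num [Nat.factorial] at this
    linarith
  have h3 : Real.exp |s * x| ≤ Real.exp (|x| / 2) := Real.exp_le_exp.2 h1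
  have h4 : Real.exp (|x| / 2) * Real.exp (|x| / 2) = Real.exp |x| := by
    rw [← Real.exp_add, add_halves]
  have h5 : (s * x) ^ 2 * Real.exp |s * x| ≤ 8 * s ^ 2 * Real.exp |x| := by
    calc (s * x) ^ 2 * Real.exp |s * x| = s ^ 2 * (x ^ 2 * Real.exp |s * x|) := by ring
      _ ≤ s ^ 2 * ((8 * Real.exp (|x| / 2)) * Real.exp (|x| / 2)) := by gcongr
      _ = 8 * s ^ 2 * (Real.exp (|x| / 2) * Real.exp (|x| / 2)) := by ring
      _ = _ := by rw [h4]
  linarith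

variable {ν : Measure ℝ}

lemma CenteredExp.integrable_pow (h : CenteredExp ν) (k : ℕ) : Integrable (fun x => x ^ k) ν := by
  refine (h.integrable_exp_abs.const_mul (2 ^ k * k.factorial)).mono'
    (by fun_prop) (ae_of_all _ fun x => ?_)
  rw [Real.norm_eq_abs, abs_pow]
  refine (abs_pow_le_factorial_mul_exp x k).trans ?_
  gcongr
  linarith [abs_nonneg x]

lemma CenteredExp.integrable_id (h : CenteredExp ν) : Integrable (fun x => x) ν := by
  simpa using h.integrable_pow 1

lemma CenteredExp.integrable_exp_mul (h : CenteredExp ν) {s : ℝ} (hs : |s| ≤ 1 / 2) :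
    Integrable (fun x => Real.exp (s * x)) ν := by
  refine h.integrable_exp_abs.mono' (by fun_prop) (ae_of_all _ fun x => ?_)
  rw [Real.norm_eq_abs, abs_of_pos (Real.exp_pos _), Real.exp_le_exp]
  refine (le_abs_self _).trans ?_
  rw [abs_mul]
  nlinarith [abs_nonneg x]

variable [IsProbabilityMeasure ν]

/-- Integrate the quadratic bound on `exp (s x)`: the linear term vanishes by centring, and `48 = 8
· 6`. -/
lemma CenteredExp.mgf_le (h : CenteredExp ν) {s : ℝ} (hs : |s| ≤ 1 / 2) :
    mgf id ν s ≤ Real.exp (48 * s ^ 2) := by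
  have h1 : mgf id ν s ≤ ∫ x, (1 + s * x + 8 * s ^ 2 * Real.exp |x|) ∂ν :=
    integral_mono (h.integrable_exp_mul hs)
      (((integrable_const _).add (h.integrable_id.const_mul _)).add
        (h.integrable_exp_abs.const_mul _)) fun x => exp_mul_le_of_abs_le_half hs x
  have h0 : Integrable (fun x => 1 + s * x) ν :=
    (integrable_const _).add (h.integrable_id.const_mul _)
  rw [integral_add h0 (h.integrable_exp_abs.const_mul _), integral_add (integrable_const _)
    (h.integrable_id.const_mul _), integral_const_mul, integral_const_mul, h.mean_eq_zero] at h1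
  simp only [integral_const, probReal_univ, smul_eq_mul, mul_one, mul_zero, add_zero] at h1
  have h2 := h.integral_exp_abs_le
  have h3 := Real.add_one_le_exp (48 * s ^ 2)
  nlinarith [sq_nonneg s]

variable {Ω : Type*} [MeasurableSpace Ω] {μ : Measure Ω} {n : ℕ}
  {Z : Fin n → Ω → ℝ}

lemma CenteredExp.mgf_sum_le (h : CenteredExp ν) (hZ : ∀ i, HasLaw (Z i) ν μ)
    (hind : iIndepFun Z μ) {s : ℝ} (hs : |s| ≤ 1 / 2) :
    mgf (∑ i, Z i) μ s ≤ Real.exp (n * (48 * s ^ 2)) := by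
  rw [hind.mgf_sum₀ fun i => (hZ i).aemeasurable]
  have h1 : ∀ i, mgf (Z i) μ s = mgf id ν s := fun i => by
    rw [← (hZ i).map_eq, mgf_id_map (hZ i).aemeasurable]
  simp only [h1, Finset.prod_const, Finset.card_univ, Fintype.card_fin]
  rw [Real.exp_nat_mul]
  exact pow_le_pow_left₀ mgf_nonneg (h.mgf_le hs) n

lemma CenteredExp.integrable_exp_sum (h : CenteredExp ν) (hZ : ∀ i, HasLaw (Z i) ν μ)
    (hind : iIndepFun Z μ) {s : ℝ} (hs : |s| ≤ 1 / 2) :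
    Integrable (fun ω => Real.exp (s * (∑ i, Z i) ω)) μ := by
  -- A non-integrable function has integral `0`, so positivity of the moment generating function
  -- proves integrability.
  refine not_imp_comm.1 integral_undef (ne_of_gt ?_)
  change 0 < mgf (∑ i, Z i) μ s
  rw [hind.mgf_sum₀ fun i => (hZ i).aemeasurable]
  refine Finset.prod_pos fun i _ => ?_
  rw [← mgf_id_map (hZ i).aemeasurable, (hZ i).map_eq]
  exact mgf_pos (h.integrable_exp_mul hs)

variable [IsProbabilityMeasure μ]

/-- A Bernstein inequality. -/
lemma CenteredExp.tail (h : CenteredExp ν) (hZ : ∀ i, HasLaw (Z i) ν μ)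
    (hind : iIndepFun Z μ) {x : ℝ} (hx : 0 ≤ x) (hx' : x ≤ 48) :
    μ.real {ω | n * x ≤ |∑ i, Z i ω|} ≤ 2 * Real.exp (-(n * x ^ 2 / 192)) := by
  -- `x / 96` minimises the Chernoff exponent `-s x + 48 s²`; `x ≤ 48` keeps it in the admissible
  -- range.
  have hs : |x / 96| ≤ 1 / 2 := by rw [abs_of_nonneg (by positivity)]; linarith
  have hs' : |-(x / 96)| ≤ 1 / 2 := by rwa [abs_neg]
  have e : -(x / 96) * (n * x) + n * (48 * (x / 96) ^ 2) = -(n * x ^ 2 / 192) := by ring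
  have h1 := (measure_ge_le_exp_mul_mgf (n * x) (by positivity : 0 ≤ x / 96)
    (h.integrable_exp_sum hZ hind hs)).trans
    (mul_le_mul_of_nonneg_left (h.mgf_sum_le hZ hind hs) (Real.exp_nonneg _))
  have h2 := (measure_le_le_exp_mul_mgf (-(n * x)) (by linarith : -(x / 96) ≤ 0)
    (h.integrable_exp_sum hZ hind hs')).trans
    (mul_le_mul_of_nonneg_left (h.mgf_sum_le hZ hind hs') (Real.exp_nonneg _))
  rw [← Real.exp_add, e] at h1
  rw [← Real.exp_add, neg_sq, neg_mul_neg, ← neg_mul, e, neg_mul] at h2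
  have hsub : {ω | n * x ≤ |∑ i, Z i ω|} ⊆
      {ω | n * x ≤ (∑ i, Z i) ω} ∪ {ω | (∑ i, Z i) ω ≤ -(n * x)} := by
    intro ω hω
    simp only [Set.mem_ofPred_eq, Set.mem_union, Finset.sum_apply] at hω ⊢
    rcases le_abs.1 hω with h | h
    · exact Or.inl h
    · right; linarith
  refine (measureReal_mono hsub).trans ((measureReal_union_le _ _).trans ?_)
  linarith

end CenteredExp

/-! ### Central limit theorem for triangular arrays -/

section CharFun

lemma norm_exp_sub_quadratic_le (y : ℝ) :
    ‖Complex.exp (y * Complex.I) - (1 + y * Complex.I - y ^ 2 / 2)‖ ≤ |y| ^ 3 * Real.exp |y| := by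
  have h := Complex.norm_exp_sub_sum_le_norm_mul_exp (y * Complex.I) 3
  simp only [Finset.sum_range_succ, Finset.sum_range_zero, norm_mul, Complex.norm_real,
    Complex.norm_I, mul_one, Real.norm_eq_abs] at h
  convert h using 3
  simp [Nat.factorial, mul_pow]
  ring

variable {ν : Measure ℝ} [IsProbabilityMeasure ν]

/-- Integrated third-order Taylor expansion, with constant `288 = 48 · 6` uniform in the law. This
uniformity replaces a Lindeberg condition when the law varies with `n`. -/
lemma CenteredExp.norm_charFun_sub_le (h : CenteredExp ν) {u : ℝ} (hu : |u| ≤ 1 / 2) :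
    ‖charFun ν u - (1 - u ^ 2 * ((∫ x, x ^ 2 ∂ν : ℝ) : ℂ) / 2)‖ ≤ 288 * |u| ^ 3 := by
  have hexp : Integrable (fun x : ℝ => Complex.exp (u * x * Complex.I)) ν := by
    refine (integrable_const (1 : ℝ)).mono' (by fun_prop) (ae_of_all _ fun x => ?_)
    rw [← Complex.ofReal_mul, Complex.norm_exp_ofReal_mul_I]
  have i1 : Integrable (fun x : ℝ => u * (x : ℂ) * Complex.I) ν :=
    (h.integrable_id.ofReal.const_mul _).mul_const _
  have i2 : Integrable (fun x : ℝ => (u : ℂ) ^ 2 / 2 * ((x ^ 2 : ℝ) : ℂ)) ν :=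
    (h.integrable_pow 2).ofReal.const_mul _
  have i4 : Integrable (fun x : ℝ => 1 + u * (x : ℂ) * Complex.I) ν := (integrable_const _).add i1
  have i3 : Integrable (fun x : ℝ => (1 + u * (x : ℂ) * Complex.I) -
      (u : ℂ) ^ 2 / 2 * ((x ^ 2 : ℝ) : ℂ)) ν := i4.sub i2
  have e1 : ∫ x : ℝ, ((1 + u * (x : ℂ) * Complex.I) - (u : ℂ) ^ 2 / 2 * ((x ^ 2 : ℝ) : ℂ)) ∂ν =
      1 - u ^ 2 * ((∫ x, x ^ 2 ∂ν : ℝ) : ℂ) / 2 := by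
    rw [integral_sub i4 i2, integral_add (integrable_const _) i1,
      integral_mul_const, integral_const_mul, integral_const_mul, integral_complex_ofReal,
      integral_complex_ofReal, h.mean_eq_zero]
    simp
    ring
  rw [charFun_apply_real, ← e1, ← integral_sub hexp i3]
  refine (norm_integral_le_of_norm_le
    (h.integrable_exp_abs.const_mul (48 * |u| ^ 3)) (ae_of_all _ fun x => ?_)).trans ?_
  · have h1 := norm_exp_sub_quadratic_le (u * x)
    have h2 : |u * x| ≤ |x| / 2 := by
      rw [abs_mul]; nlinarith [abs_nonneg x]
    have h3 : |x| ^ 3 ≤ 48 * Real.exp (|x| / 2) := by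
      have := abs_pow_le_factorial_mul_exp x 3
      norm_num [Nat.factorial] at this
      linarith
    have h4 : Real.exp (|x| / 2) * Real.exp (|x| / 2) = Real.exp |x| := by
      rw [← Real.exp_add, add_halves]
    have h5 : |u * x| ^ 3 * Real.exp |u * x| ≤ 48 * |u| ^ 3 * Real.exp |x| := by
      calc |u * x| ^ 3 * Real.exp |u * x| ≤ |u * x| ^ 3 * Real.exp (|x| / 2) := by gcongr
        _ = |u| ^ 3 * (|x| ^ 3 * Real.exp (|x| / 2)) := by rw [abs_mul]; ring
        _ ≤ |u| ^ 3 * (48 * Real.exp (|x| / 2) * Real.exp (|x| / 2)) := by gcongr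
        _ = 48 * |u| ^ 3 * (Real.exp (|x| / 2) * Real.exp (|x| / 2)) := by ring
        _ = _ := by rw [h4]
    refine le_trans (le_of_eq ?_) (h1.trans h5)
    congr 1
    push_cast
    ring
  · rw [integral_const_mul]
    have := h.integral_exp_abs_le
    have : 0 ≤ |u| ^ 3 := by positivity
    nlinarith

/-- A central limit theorem for triangular arrays with identically distributed rows. -/
theorem tendsto_charFun_row_sum {ν : ℕ → Measure ℝ} [∀ n, IsProbabilityMeasure (ν n)]
    {Ω : ℕ → Type*} [∀ n, MeasurableSpace (Ω n)] {μ : ∀ n, Measure (Ω n)}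
    [∀ n, IsProbabilityMeasure (μ n)] {Z : ∀ n, Fin n → Ω n → ℝ}
    (hν : ∀ n, CenteredExp (ν n)) (hZ : ∀ n i, HasLaw (Z n i) (ν n) (μ n))
    (hind : ∀ n, iIndepFun (Z n) (μ n)) {a : ℕ → ℝ} {C : ℝ}
    (ha : ∀ᶠ n in atTop, a n ^ 2 * ∫ x, x ^ 2 ∂(ν n) = 1 ∧ |a n| ≤ C) (t : ℝ) :
    Tendsto (fun n => charFun ((μ n).map fun ω => a n / √(n : ℝ) * ∑ i, Z n i ω) t) atTop
      (𝓝 (Complex.exp (-t ^ 2 / 2))) := by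
  have h1 : ∀ n, charFun ((μ n).map fun ω => a n / √(n : ℝ) * ∑ i, Z n i ω) t =
      charFun (ν n) (a n / √(n : ℝ) * t) ^ n := by
    intro n
    rw [charFun_map_mul_comp (Finset.aemeasurable_fun_sum _ fun i _ => (hZ n i).aemeasurable),
      (hind n).charFun_map_fun_sum_eq_prod fun i => (hZ n i).aemeasurable]
    simp [fun i => (hZ n i).map_eq]
  simp only [h1]
  -- It remains to see that each factor is `1 - t²/(2n) + o(1/n)`; the Taylor error is in fact
  -- `O(n^{-3/2})`.
  refine Complex.tendsto_pow_exp_of_isLittleO_sub_add_div _ ?_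
  have hsqrt : Tendsto (fun n : ℕ => (√(n : ℝ))⁻¹) atTop (𝓝 0) :=
    tendsto_inv_atTop_zero.comp (Real.tendsto_sqrt_atTop.comp tendsto_natCast_atTop_atTop)
  have hbound : ∀ᶠ n : ℕ in atTop, ‖charFun (ν n) (a n / √(n : ℝ) * t) -
      (1 + (-t ^ 2 / 2 : ℂ) / n)‖ ≤ 288 * (C * |t|) ^ 3 * (√(n : ℝ))⁻¹ * ‖(1 / (n : ℂ))‖ := by
    have hsmall : ∀ᶠ n : ℕ in atTop, C * |t| * (√(n : ℝ))⁻¹ < 1 / 2 := by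
      have := hsqrt.const_mul (C * |t|)
      rw [mul_zero] at this
      exact this.eventually_lt_const (by norm_num)
    filter_upwards [ha, hsmall, eventually_gt_atTop 0] with n ⟨h2, h3⟩ h4 h5
    have hn : (0 : ℝ) < n := by exact_mod_cast h5
    have hsn : 0 < √(n : ℝ) := Real.sqrt_pos.2 hn
    have hu : |a n / √(n : ℝ) * t| ≤ C * |t| * (√(n : ℝ))⁻¹ := by
      rw [abs_mul, abs_div, abs_of_pos hsn, div_eq_mul_inv]
      calc |a n| * (√(n : ℝ))⁻¹ * |t| ≤ C * (√(n : ℝ))⁻¹ * |t| := by gcongr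
        _ = _ := by ring
    have h6 := (hν n).norm_charFun_sub_le (hu.trans h4.le)
    have e : (1 : ℂ) - ((a n / √(n : ℝ) * t : ℝ) : ℂ) ^ 2 * ((∫ x, x ^ 2 ∂(ν n) : ℝ) : ℂ) / 2 =
        1 + (-t ^ 2 / 2 : ℂ) / n := by
      have : (a n / √(n : ℝ) * t) ^ 2 * (∫ x, x ^ 2 ∂(ν n)) / 2 = t ^ 2 / 2 / n := by
        rw [mul_pow, div_pow, Real.sq_sqrt hn.le]
        calc a n ^ 2 / n * t ^ 2 * (∫ x, x ^ 2 ∂(ν n)) / 2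
            = (a n ^ 2 * ∫ x, x ^ 2 ∂(ν n)) * (t ^ 2 / 2 / n) := by ring
          _ = _ := by rw [h2, one_mul]
      rw [← Complex.ofReal_pow, ← Complex.ofReal_mul, ← Complex.ofReal_ofNat,
        ← Complex.ofReal_div, this]
      push_cast
      ring
    rw [e] at h6
    refine h6.trans ?_
    have h7 : ‖(1 / (n : ℂ))‖ = (√(n : ℝ))⁻¹ ^ 2 := by
      rw [norm_div, norm_one, Complex.norm_natCast, inv_pow, Real.sq_sqrt hn.le, one_div]
    rw [h7]
    calc 288 * |a n / √(n : ℝ) * t| ^ 3 ≤ 288 * (C * |t| * (√(n : ℝ))⁻¹) ^ 3 := by gcongr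
      _ = _ := by ring
  have hlim : Tendsto (fun n : ℕ => 288 * (C * |t|) ^ 3 * (√(n : ℝ))⁻¹) atTop (𝓝 0) := by
    simpa using hsqrt.const_mul (288 * (C * |t|) ^ 3)
  rw [isLittleO_iff]
  intro c hc
  filter_upwards [hbound, hlim.eventually_lt_const hc] with n h2 h3
  exact h2.trans (by gcongr)

end CharFun

/-! ### Products of sub-Gaussian linear forms -/

section SubGaussian

variable {p : ℕ} {K R : ℝ} {P : Measure (Fin p → ℝ)} {α β : Fin p → ℝ}

lemma measurable_dotProduct (α : Fin p → ℝ) : Measurable fun x : Fin p → ℝ => α ⬝ᵥ x := by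
  unfold dotProduct
  fun_prop

lemma SubGaussian.lintegral_le (h : SubGaussian K P)
    [IsProbabilityMeasure P] (hα : ∑ k, α k ^ 2 ≤ R ^ 2) :
    ∫⁻ x, ENNReal.ofReal (Real.exp ((α ⬝ᵥ x) ^ 2 / (K ^ 2 * R ^ 2))) ∂P ≤ 2 := by
  have h0 : 0 ≤ ∑ k, α k ^ 2 := Finset.sum_nonneg fun _ _ => sq_nonneg _
  set N := √(∑ k, α k ^ 2) with hN
  have hN2 : N ^ 2 = ∑ k, α k ^ 2 := Real.sq_sqrt h0
  have hN0 : 0 ≤ N := Real.sqrt_nonneg _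
  rcases hN0.eq_or_lt with hz | hpos
  · have hα0 : α = 0 := by
      rw [← hz] at hN2
      have h1 := (Finset.sum_eq_zero_iff_of_nonneg fun k _ => sq_nonneg (α k)).1
        (by rw [← hN2]; norm_num)
      ext k
      exact pow_eq_zero_iff (two_ne_zero) |>.1 (h1 k (Finset.mem_univ k))
    simp [hα0]
  · have h1 := h (N⁻¹ • α) (by
      simp only [Pi.smul_apply, smul_eq_mul, mul_pow]
      rw [← Finset.mul_sum, ← hN2, inv_pow, inv_mul_cancel₀ (by positivity), Real.sqrt_one])
    refine (lintegral_mono fun x => ?_).trans h1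
    refine ENNReal.ofReal_le_ofReal (Real.exp_le_exp.2 ?_)
    rw [smul_dotProduct, smul_eq_mul, sq_abs, mul_pow, inv_pow, mul_comm (K ^ 2), ← div_div]
    gcongr
    rw [← div_eq_inv_mul]
    have : N ^ 2 ≤ R ^ 2 := hN2.trans_le hα
    gcongr

lemma SubGaussian.integrable_exp [IsProbabilityMeasure P] (h : SubGaussian K P)
    (hα : ∑ k, α k ^ 2 ≤ R ^ 2) :
    Integrable (fun x => Real.exp ((α ⬝ᵥ x) ^ 2 / (K ^ 2 * R ^ 2))) P := by
  have hm := measurable_dotProduct α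
  rw [← lintegral_ofReal_ne_top_iff_integrable (by fun_prop)
    (ae_of_all _ fun x => (Real.exp_pos _).le)]
  exact ((h.lintegral_le hα).trans_lt (by norm_num)).ne

lemma SubGaussian.integral_exp_le [IsProbabilityMeasure P] (h : SubGaussian K P)
    (hα : ∑ k, α k ^ 2 ≤ R ^ 2) :
    ∫ x, Real.exp ((α ⬝ᵥ x) ^ 2 / (K ^ 2 * R ^ 2)) ∂P ≤ 2 := by
  have hm := measurable_dotProduct α
  rw [integral_eq_lintegral_of_nonneg_ae (ae_of_all _ fun x => (Real.exp_pos _).le) (by fun_prop)]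
  exact ENNReal.toReal_le_of_le_ofReal (by norm_num) (by simpa using h.lintegral_le hα)

/-- The product of two linear forms, scaled by `K² R²`. -/
noncomputable def scaledProd (K R : ℝ) (α β x : Fin p → ℝ) : ℝ := (α ⬝ᵥ x) * (β ⬝ᵥ x) / (K ^ 2 * R ^ 2)

lemma measurable_scaledProd (K R : ℝ) (α β : Fin p → ℝ) :
    Measurable (scaledProd K R α β) := by
  have := measurable_dotProduct α
  have := measurable_dotProduct β
  unfold scaledProd
  fun_prop

/-- The arithmetic-geometric mean inequality, once for the product in the exponent and once for the
product of exponentials: a product of sub-Gaussian forms is sub-exponential. -/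
lemma exp_abs_scaledProd_le (hK : 0 < K) (hR : 0 < R) (x : Fin p → ℝ) :
    Real.exp |scaledProd K R α β x| ≤ 1 / 2 * (Real.exp ((α ⬝ᵥ x) ^ 2 / (K ^ 2 * R ^ 2)) +
      Real.exp ((β ⬝ᵥ x) ^ 2 / (K ^ 2 * R ^ 2))) := by
  set u := (α ⬝ᵥ x) ^ 2 / (K ^ 2 * R ^ 2)
  set v := (β ⬝ᵥ x) ^ 2 / (K ^ 2 * R ^ 2)
  have h1 : |scaledProd K R α β x| ≤ u / 2 + v / 2 := by
    unfold scaledProd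
    rw [abs_div, abs_mul, abs_of_pos (by positivity : 0 < K ^ 2 * R ^ 2), ← add_div,
      ← add_div, div_div, div_le_div_iff₀ (by positivity) (by positivity)]
    have h2 : |α ⬝ᵥ x| * |β ⬝ᵥ x| * 2 ≤ (α ⬝ᵥ x) ^ 2 + (β ⬝ᵥ x) ^ 2 := by
      rw [← sq_abs (α ⬝ᵥ x), ← sq_abs (β ⬝ᵥ x)]
      nlinarith [sq_nonneg (|α ⬝ᵥ x| - |β ⬝ᵥ x|)]
    have h3 : 0 ≤ K ^ 2 * R ^ 2 := by positivity
    nlinarith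
  refine (Real.exp_le_exp.2 h1).trans ?_
  rw [Real.exp_add]
  have e1 : Real.exp u = Real.exp (u / 2) ^ 2 := by rw [← Real.exp_nat_mul]; ring_nf
  have e2 : Real.exp v = Real.exp (v / 2) ^ 2 := by rw [← Real.exp_nat_mul]; ring_nf
  rw [e1, e2]
  nlinarith [sq_nonneg (Real.exp (u / 2) - Real.exp (v / 2))]

/-- The law of the centred scaled product of two linear forms. -/
noncomputable def crossLaw (P : Measure (Fin p → ℝ)) (K R : ℝ) (α β : Fin p → ℝ) : Measure ℝ :=
  P.map fun x => scaledProd K R α β x - ∫ y, scaledProd K R α β y ∂P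

lemma measurable_centered (P : Measure (Fin p → ℝ)) (K R : ℝ) (α β : Fin p → ℝ) :
    Measurable fun x => scaledProd K R α β x - ∫ y, scaledProd K R α β y ∂P :=
  (measurable_scaledProd K R α β).sub_const _

variable {Ω : Type*} [MeasurableSpace Ω] {μ : Measure Ω} {n : ℕ} {X : Fin n → Ω → Fin p → ℝ}

/-- The centred scaled products of two linear forms of the observations. -/
noncomputable def crossVar (P : Measure (Fin p → ℝ)) (K R : ℝ) (α β : Fin p → ℝ) (X : Fin n → Ω → Fin p → ℝ)
    (i : Fin n) (ω : Ω) : ℝ :=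
  scaledProd K R α β (X i ω) - ∫ y, scaledProd K R α β y ∂P

lemma hasLaw_crossVar (hX : ∀ i, HasLaw (X i) P μ) (i : Fin n) :
    HasLaw (crossVar P K R α β X i) (crossLaw P K R α β) μ :=
  have h : HasLaw (fun x => scaledProd K R α β x - ∫ y, scaledProd K R α β y ∂P)
      (crossLaw P K R α β) P := ⟨(measurable_centered P K R α β).aemeasurable, rfl⟩
  h.fun_comp (hX i)

lemma iIndepFun_crossVar (hX : iIndepFun X μ) : iIndepFun (crossVar P K R α β X) μ :=
  hX.comp (fun _ x => scaledProd K R α β x - ∫ y, scaledProd K R α β y ∂P)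
    fun _ => measurable_centered P K R α β

variable [IsProbabilityMeasure P]

lemma SubGaussian.integrable_exp_abs_scaledProd (h : SubGaussian K P) (hK : 0 < K) (hR : 0 < R)
    (hα : ∑ k, α k ^ 2 ≤ R ^ 2) (hβ : ∑ k, β k ^ 2 ≤ R ^ 2) :
    Integrable (fun x => Real.exp |scaledProd K R α β x|) P := by
  have hm := measurable_scaledProd K R α β
  refine (((h.integrable_exp hα).add (h.integrable_exp hβ)).const_mul (1 / 2)).mono'
    (by fun_prop) (ae_of_all _ fun x => ?_)
  rw [Real.norm_eq_abs, abs_of_pos (Real.exp_pos _)]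
  exact exp_abs_scaledProd_le hK hR x

lemma SubGaussian.integral_exp_abs_scaledProd_le (h : SubGaussian K P) (hK : 0 < K) (hR : 0 < R)
    (hα : ∑ k, α k ^ 2 ≤ R ^ 2) (hβ : ∑ k, β k ^ 2 ≤ R ^ 2) :
    ∫ x, Real.exp |scaledProd K R α β x| ∂P ≤ 2 := by
  have h1 := integral_mono (h.integrable_exp_abs_scaledProd hK hR hα hβ)
    (((h.integrable_exp hα).add (h.integrable_exp hβ)).const_mul (1 / 2))
    fun x => exp_abs_scaledProd_le hK hR x
  refine h1.trans ?_
  rw [integral_const_mul]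
  simp only [Pi.add_apply]
  rw [integral_add (h.integrable_exp hα) (h.integrable_exp hβ)]
  linarith [h.integral_exp_le hα, h.integral_exp_le hβ]

lemma SubGaussian.integrable_scaledProd (h : SubGaussian K P) (hK : 0 < K) (hR : 0 < R)
    (hα : ∑ k, α k ^ 2 ≤ R ^ 2) (hβ : ∑ k, β k ^ 2 ≤ R ^ 2) :
    Integrable (scaledProd K R α β) P := by
  refine (h.integrable_exp_abs_scaledProd hK hR hα hβ).mono'
    (measurable_scaledProd K R α β).aestronglyMeasurable (ae_of_all _ fun x => ?_)
  rw [Real.norm_eq_abs]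
  linarith [Real.add_one_le_exp |scaledProd K R α β x|]

instance : IsProbabilityMeasure (crossLaw P K R α β) :=
  Measure.isProbabilityMeasure_map (measurable_centered P K R α β).aemeasurable

lemma SubGaussian.centeredExp (h : SubGaussian K P) (hK : 0 < K) (hR : 0 < R)
    (hα : ∑ k, α k ^ 2 ≤ R ^ 2) (hβ : ∑ k, β k ^ 2 ≤ R ^ 2) :
    CenteredExp (crossLaw P K R α β) := by
  have hi := h.integrable_scaledProd hK hR hα hβ
  have he := h.integrable_exp_abs_scaledProd hK hR hα hβ
  have he2 := h.integral_exp_abs_scaledProd_le hK hR hα hβ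
  have hm := measurable_centered P K R α β
  set m := ∫ y, scaledProd K R α β y ∂P with hm_def
  -- From `|z| ≤ exp |z| - 1` and `E exp |z| ≤ 2`. Centring thus costs a factor `e`, and `2e < 6`
  -- explains the bound in `CenteredExp`.
  have hm1 : |m| ≤ 1 := by
    have h1 : |m| ≤ ∫ y, |scaledProd K R α β y| ∂P := abs_integral_le_integral_abs
    have h2 : ∫ y, |scaledProd K R α β y| ∂P ≤
        ∫ y, (Real.exp |scaledProd K R α β y| - 1) ∂P :=
      integral_mono hi.abs (he.sub (integrable_const 1)) fun y => by
        linarith [Real.add_one_le_exp |scaledProd K R α β y|]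
    rw [integral_sub he (integrable_const 1)] at h2
    simp only [integral_const, probReal_univ, smul_eq_mul, mul_one] at h2
    linarith
  have hpt : ∀ x, Real.exp |scaledProd K R α β x - m| ≤
      Real.exp 1 * Real.exp |scaledProd K R α β x| := fun x => by
    rw [← Real.exp_add, Real.exp_le_exp]
    linarith [abs_sub (scaledProd K R α β x) m]
  have hint : Integrable (fun x => Real.exp |scaledProd K R α β x - m|) P := by
    refine (he.const_mul (Real.exp 1)).mono' (by fun_prop) (ae_of_all _ fun x => ?_)
    rw [Real.norm_eq_abs, abs_of_pos (Real.exp_pos _)]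
    exact hpt x
  refine ⟨?_, ?_, ?_⟩
  · exact (integrable_map_measure (by fun_prop) hm.aemeasurable).2 hint
  · rw [crossLaw, integral_map hm.aemeasurable (by fun_prop)]
    refine (integral_mono hint (he.const_mul (Real.exp 1)) hpt).trans ?_
    rw [integral_const_mul]
    have h3 := Real.exp_one_lt_d9
    nlinarith [Real.exp_pos 1]
  · rw [crossLaw, integral_map hm.aemeasurable (by fun_prop), integral_sub hi (integrable_const _)]
    simp [hm_def]

lemma SubGaussian.integrable_coord_mul (h : SubGaussian K P) (hK : 0 < K) (j k : Fin p) :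
    Integrable (fun x => x j * x k) P := by
  have h1 := (h.integrable_scaledProd hK one_pos (α := Pi.single j 1) (β := Pi.single k 1)
    (by rw [sum_single_sq]; norm_num) (by rw [sum_single_sq]; norm_num)).const_mul (K ^ 2)
  refine h1.congr (ae_of_all _ fun x => ?_)
  simp only [scaledProd, single_dotProduct, one_mul, one_pow, mul_one]
  field_simp

lemma SubGaussian.bil_popCov (h : SubGaussian K P) (hK : 0 < K) (hmean : ∀ k, ∫ x, x k ∂P = 0)
    (α β : Fin p → ℝ) : bil (popCov P) α β = ∫ x, (α ⬝ᵥ x) * (β ⬝ᵥ x) ∂P := by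
  have h1 : ∀ x : Fin p → ℝ, (α ⬝ᵥ x) * (β ⬝ᵥ x) = ∑ j, ∑ k, α j * β k * (x j * x k) := by
    intro x
    unfold dotProduct
    rw [Finset.sum_mul_sum]
    exact Finset.sum_congr rfl fun j _ => Finset.sum_congr rfl fun k _ => by ring
  have h2 : ∀ j k, Integrable (fun x : Fin p → ℝ => α j * β k * (x j * x k)) P := fun j k =>
    (h.integrable_coord_mul hK j k).const_mul _
  simp only [h1]
  rw [integral_finsetSum _ fun j _ => integrable_finsetSum _ fun k _ => h2 j k]
  unfold bil dotProduct
  refine Finset.sum_congr rfl fun j _ => ?_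
  rw [integral_finsetSum _ fun k _ => h2 j k]
  simp only [Matrix.mulVec, dotProduct, Finset.mul_sum]
  refine Finset.sum_congr rfl fun k _ => ?_
  rw [integral_const_mul]
  simp only [popCov, Matrix.of_apply, covariance, hmean, sub_zero]
  ring

lemma SubGaussian.bil_sampleCov_sub (h : SubGaussian K P) (hK : 0 < K) (hR : 0 < R)
    (hmean : ∀ k, ∫ x, x k ∂P = 0) (hn : 0 < n) {Ω' : Type*} {X : Fin n → Ω' → Fin p → ℝ} (ω : Ω') :
    bil (sampleCov (dataMatrix X ω) - popCov P) α β =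
      K ^ 2 * R ^ 2 / n * ∑ i, crossVar P K R α β X i ω := by
  rw [bil_sub_mat, bil_sampleCov, h.bil_popCov hK hmean]
  simp only [crossVar, Finset.sum_sub_distrib, Finset.sum_const, Finset.card_univ,
    Fintype.card_fin, nsmul_eq_mul]
  unfold scaledProd
  rw [integral_div, ← Finset.sum_div]
  have e : ∀ i, (dataMatrix X ω *ᵥ α) i * (dataMatrix X ω *ᵥ β) i =
      (α ⬝ᵥ X i ω) * (β ⬝ᵥ X i ω) := fun i => by
    rw [dotProduct_comm α, dotProduct_comm β]; rfl
  simp only [e]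
  have hn' : (n : ℝ) ≠ 0 := by positivity
  field_simp

/-- Concentration of a bilinear form in the sample covariance matrix. -/
lemma SubGaussian.tail_bil [IsProbabilityMeasure μ] (h : SubGaussian K P) (hK : 0 < K) (hR : 0 < R)
    (hmean : ∀ k, ∫ x, x k ∂P = 0) (hX : ∀ i, HasLaw (X i) P μ) (hind : iIndepFun X μ)
    (hn : 0 < n) (hα : ∑ k, α k ^ 2 ≤ R ^ 2) (hβ : ∑ k, β k ^ 2 ≤ R ^ 2) {ρ : ℝ} (hρ : 0 ≤ ρ)
    (hρ' : ρ ≤ 48 * (K ^ 2 * R ^ 2)) :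
    μ.real {ω | ρ < |bil (sampleCov (dataMatrix X ω) - popCov P) α β|} ≤
      2 * Real.exp (-(n * ρ ^ 2 / (192 * (K ^ 2 * R ^ 2) ^ 2))) := by
  have hκ : 0 < K ^ 2 * R ^ 2 := by positivity
  have hn' : (0 : ℝ) < n := by exact_mod_cast hn
  have h1 := (h.centeredExp hK hR hα hβ).tail (hasLaw_crossVar hX) (iIndepFun_crossVar hind)
    (x := ρ / (K ^ 2 * R ^ 2)) (by positivity) (by rwa [div_le_iff₀ hκ])
  have e : n * (ρ / (K ^ 2 * R ^ 2)) ^ 2 / 192 = n * ρ ^ 2 / (192 * (K ^ 2 * R ^ 2) ^ 2) := by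
    field_simp
  rw [e] at h1
  refine (measureReal_mono fun ω hω => ?_).trans h1
  simp only [Set.mem_ofPred_eq] at hω ⊢
  rw [h.bil_sampleCov_sub hK hR hmean hn, abs_mul, abs_of_pos (by positivity)] at hω
  rw [← mul_div_assoc, div_le_iff₀ hκ]
  rw [div_mul_eq_mul_div, lt_div_iff₀ hn'] at hω
  linarith

/-- The form is a constant plus `K²R²/n` times a sum of `n` independent variables with law
`crossLaw`, so the powers of `n` cancel. This matches the standardisation in the limit law with the
second moment in the central limit theorem. -/
lemma SubGaussian.asympSd_sq [IsProbabilityMeasure μ] (h : SubGaussian K P) (hK : 0 < K)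
    (hR : 0 < R) (hmean : ∀ k, ∫ x, x k ∂P = 0) (hX : ∀ i, HasLaw (X i) P μ)
    (hind : iIndepFun X μ) (hn : 0 < n) {Θ : Matrix (Fin p) (Fin p) ℝ} {i j : Fin p}
    (hi : ∑ k, Θ k i ^ 2 ≤ R ^ 2) (hj : ∑ k, Θ k j ^ 2 ≤ R ^ 2) :
    asympSd μ X Θ i j ^ 2 = (K ^ 2 * R ^ 2) ^ 2 *
      ∫ x, x ^ 2 ∂(crossLaw P K R (fun k => Θ k i) (fun k => Θ k j)) := by
  set α := fun k => Θ k i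
  set β := fun k => Θ k j
  have hc := h.centeredExp hK hR hi hj
  have hn' : (0 : ℝ) < n := by exact_mod_cast hn
  unfold asympSd
  rw [Real.sq_sqrt (mul_nonneg hn'.le (variance_nonneg _ _))]
  have hrep : (fun ω => α ⬝ᵥ (sampleCov (dataMatrix X ω) *ᵥ β)) =
      fun ω => K ^ 2 * R ^ 2 / n * (∑ l, crossVar P K R α β X l) ω + bil (popCov P) α β := by
    ext ω
    have := h.bil_sampleCov_sub hK hR hmean hn (X := X) (α := α) (β := β) ω
    rw [bil_sub_mat] at this
    rw [Finset.sum_apply, ← this]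
    simp [bil]
  have hL2 : MemLp (fun x : ℝ => x) 2 (crossLaw P K R α β) :=
    (memLp_two_iff_integrable_sq (by fun_prop)).2 (hc.integrable_pow 2)
  have hL : ∀ l, MemLp (crossVar P K R α β X l) 2 μ := fun l => by
    rw [← (hasLaw_crossVar hX l).map_eq] at hL2
    exact hL2.comp_of_map (hasLaw_crossVar hX l).aemeasurable
  have hV : ∀ l, Var[crossVar P K R α β X l; μ] = ∫ x, x ^ 2 ∂(crossLaw P K R α β) := fun l => by
    have hlaw := hasLaw_crossVar (K := K) (R := R) (α := α) (β := β) hX l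
    rw [hlaw.variance_eq]
    exact variance_of_integral_eq_zero (X := id) aemeasurable_id hc.mean_eq_zero
  change (n : ℝ) * Var[fun ω => α ⬝ᵥ (sampleCov (dataMatrix X ω) *ᵥ β); μ] = _
  rw [hrep, variance_add_const
      (((memLp_finsetSum' _ fun l _ => hL l).const_mul _).aestronglyMeasurable),
    variance_const_mul, IndepFun.variance_sum (fun l _ => hL l) fun l _ m _ hlm =>
      (iIndepFun_crossVar hind).indepFun hlm]
  simp only [hV, Finset.sum_const, Finset.card_univ, Fintype.card_fin, nsmul_eq_mul]
  field_simp

end SubGaussian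

/-! ### Measurability of the estimator -/

section Measurability

variable {n p : ℕ} {Ω : Type*} [MeasurableSpace Ω] {μ : Measure Ω} {X : Fin n → Ω → Fin p → ℝ}
  {lam : ℝ} {γ : Ω → (j : Fin p) → {k : Fin p // k ≠ j} → ℝ}

lemma aemeasurable_dataMatrix_apply (hX : ∀ i, AEMeasurable (X i) μ) (i : Fin n) (k : Fin p) :
    AEMeasurable (fun ω => dataMatrix X ω i k) μ :=
  (measurable_pi_apply k).comp_aemeasurable (hX i)

lemma aemeasurable_sampleCov_apply (hX : ∀ i, AEMeasurable (X i) μ) (j k : Fin p) :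
    AEMeasurable (fun ω => sampleCov (dataMatrix X ω) j k) μ := by
  simp only [sampleCov, Matrix.smul_apply, Matrix.mul_apply, Matrix.transpose_apply, smul_eq_mul]
  exact (Finset.aemeasurable_fun_sum _ fun i _ => (aemeasurable_dataMatrix_apply hX i j).mul
    (aemeasurable_dataMatrix_apply hX i k)).const_mul _

lemma aemeasurable_coef (hγ : ∀ j, AEMeasurable (fun ω => γ ω j) μ) (j : Fin p)
    (k : {k : Fin p // k ≠ j}) : AEMeasurable (fun ω => γ ω j k) μ :=
  (measurable_pi_apply k).comp_aemeasurable (hγ j)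

lemma aemeasurable_noiseLevel (hX : ∀ i, AEMeasurable (X i) μ)
    (hγ : ∀ j, AEMeasurable (fun ω => γ ω j) μ) (j : Fin p) :
    AEMeasurable (fun ω => noiseLevel (dataMatrix X ω) j (γ ω j)) μ := by
  have hres : ∀ i, AEMeasurable (fun ω => residual (dataMatrix X ω) j (γ ω j) i) μ := by
    intro i
    have h : ∀ k : {k : Fin p // k ≠ j},
        AEMeasurable (fun ω => dataMatrix X ω i k * γ ω j k) μ := fun k =>
      (aemeasurable_dataMatrix_apply hX i k).mul (aemeasurable_coef hγ j k)
    exact (aemeasurable_dataMatrix_apply hX i j).sub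
      (Finset.aemeasurable_fun_sum Finset.univ fun k _ => h k)
  have hsum : AEMeasurable (fun ω => ∑ i, residual (dataMatrix X ω) j (γ ω j) i ^ 2) μ :=
    Finset.aemeasurable_fun_sum _ fun i _ => (hres i).pow_const 2
  exact hsum.sqrt.div_const _

lemma aemeasurable_tauTildeSq (hX : ∀ i, AEMeasurable (X i) μ)
    (hγ : ∀ j, AEMeasurable (fun ω => γ ω j) μ) (j : Fin p) :
    AEMeasurable (fun ω => tauTildeSq (dataMatrix X ω) lam j (γ ω j)) μ := by
  unfold tauTildeSq
  have h := aemeasurable_noiseLevel hX hγ j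
  exact (h.pow_const 2).add ((h.const_mul lam).mul
    (Finset.aemeasurable_fun_sum _ fun k _ => (aemeasurable_coef hγ j k).abs))

lemma aemeasurable_nodewise_apply (hX : ∀ i, AEMeasurable (X i) μ)
    (hγ : ∀ j, AEMeasurable (fun ω => γ ω j) μ) (k j : Fin p) :
    AEMeasurable (fun ω => nodewise (dataMatrix X ω) lam (γ ω) k j) μ := by
  have h := aemeasurable_tauTildeSq (lam := lam) hX hγ j
  simp only [nodewise, Matrix.of_apply]
  split_ifs with hkj
  · exact h.const_div 1
  · exact (aemeasurable_coef hγ j ⟨k, hkj⟩).neg.div h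

lemma aemeasurable_debiased_apply (hX : ∀ i, AEMeasurable (X i) μ)
    (hγ : ∀ j, AEMeasurable (fun ω => γ ω j) μ) (i j : Fin p) :
    AEMeasurable (fun ω => debiased (dataMatrix X ω) lam (γ ω) i j) μ := by
  have h := fun k j => aemeasurable_nodewise_apply (lam := lam) hX hγ k j
  simp only [debiased, Matrix.sub_apply, Matrix.add_apply, Matrix.transpose_apply,
    Matrix.mul_apply]
  exact ((h i j).add (h j i)).sub (Finset.aemeasurable_fun_sum _ fun k _ =>
    (Finset.aemeasurable_fun_sum _ fun l _ =>
      (h l i).mul (aemeasurable_sampleCov_apply hX l k)).mul (h k j))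

end Measurability

/-! ### Stochastic orders and Slutsky's lemma -/

section Orders

variable {Ω : ℕ → Type*} [∀ n, MeasurableSpace (Ω n)] {μ : ∀ n, Measure (Ω n)}
  [∀ n, IsProbabilityMeasure (μ n)]

lemma IsBigOP.isLittleOP {Y : ∀ n, Ω n → ℝ} {a b : ℕ → ℝ} (h : IsBigOP μ Y a)
    (hab : a =o[atTop] b) (hb : ∀ n, 0 ≤ b n) : IsLittleOP μ Y b := by
  intro ε hε
  rw [Metric.tendsto_atTop']
  intro δ hδ
  obtain ⟨M, hM⟩ := h (δ / 2) (by positivity)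
  have h1 := hab.def (c := ε / (|M| + 1)) (by positivity)
  obtain ⟨N, hN⟩ := eventually_atTop.1 (hM.and h1)
  refine ⟨N, fun n hn => ?_⟩
  obtain ⟨h2, h3⟩ := hN n hn.le
  rw [Real.dist_eq, sub_zero, abs_of_nonneg measureReal_nonneg]
  refine lt_of_le_of_lt ((measureReal_mono fun ω hω => ?_).trans h2) (by linarith)
  simp only [Set.mem_ofPred_eq] at hω ⊢
  refine lt_of_le_of_lt ?_ hω
  rw [Real.norm_eq_abs, Real.norm_eq_abs, abs_of_nonneg (hb n), div_mul_eq_mul_div,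
    le_div_iff₀ (by positivity)] at h3
  calc M * a n ≤ |M * a n| := le_abs_self _
    _ = |a n| * |M| := by rw [abs_mul, mul_comm]
    _ ≤ |a n| * (|M| + 1) := by gcongr; linarith
    _ ≤ ε * b n := h3

/-- Adding a term that vanishes in probability does not change the limit of the characteristic
functions. -/
lemma tendsto_charFun_add_of_isLittleOP {W V : ∀ n, Ω n → ℝ} {t : ℝ} {z : ℂ}
    (hW : ∀ n, AEMeasurable (W n) (μ n)) (hV : ∀ n, AEMeasurable (V n) (μ n))
    (h : Tendsto (fun n => charFun ((μ n).map (W n)) t) atTop (𝓝 z))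
    (hV0 : IsLittleOP μ V fun _ => 1) :
    Tendsto (fun n => charFun ((μ n).map fun ω => W n ω + V n ω) t) atTop (𝓝 z) := by
  have hdiff : ∀ ε : ℝ, 0 < ε → ∀ n,
      ‖charFun ((μ n).map fun ω => W n ω + V n ω) t - charFun ((μ n).map (W n)) t‖ ≤
        |t| * ε + 2 * (μ n).real {ω | ε * 1 < |V n ω|} := by
    intro ε hε n
    -- `V n` is only a.e. measurable, so a measurable hull of the same measure is used for the
    -- indicator. Off it the integrands differ by at most `|t| ε`, on it by at most `2`.
    set B := toMeasurable (μ n) {ω | ε * 1 < |V n ω|} with hB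
    have hBm : MeasurableSet B := measurableSet_toMeasurable _ _
    have hBμ : (μ n).real B = (μ n).real {ω | ε * 1 < |V n ω|} := by
      simp only [Measure.real, hB, measure_toMeasurable]
    have hint : ∀ Y : Ω n → ℝ, AEMeasurable Y (μ n) →
        Integrable (fun ω => Complex.exp (t * Y ω * Complex.I)) (μ n) := by
      intro Y hY
      refine (integrable_const (1 : ℝ)).mono' (by fun_prop) (ae_of_all _ fun ω => ?_)
      rw [← Complex.ofReal_mul, Complex.norm_exp_ofReal_mul_I]
    have hcf : ∀ Y : Ω n → ℝ, AEMeasurable Y (μ n) →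
        charFun ((μ n).map Y) t = ∫ ω, Complex.exp (t * Y ω * Complex.I) ∂(μ n) := by
      intro Y hY
      rw [charFun_apply_real, integral_map hY (by fun_prop)]
    have hWV : AEMeasurable (fun ω => W n ω + V n ω) (μ n) := (hW n).add (hV n)
    rw [hcf _ hWV, hcf _ (hW n), ← integral_sub (hint _ hWV) (hint _ (hW n)), ← hBμ]
    have hI : Integrable (fun ω => |t| * ε + B.indicator (fun _ => (2 : ℝ)) ω) (μ n) :=
      (integrable_const _).add ((integrable_const _).indicator hBm)
    refine (norm_integral_le_of_norm_le hI (ae_of_all _ fun ω => ?_)).trans (le_of_eq ?_)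
    · by_cases hω : ω ∈ B
      · rw [Set.indicator_of_mem hω]
        refine (norm_sub_le _ _).trans ?_
        rw [← Complex.ofReal_mul, ← Complex.ofReal_mul, Complex.norm_exp_ofReal_mul_I,
          Complex.norm_exp_ofReal_mul_I]
        have : 0 ≤ |t| * ε := by positivity
        linarith
      · rw [Set.indicator_of_notMem hω, add_zero]
        have h1 : |V n ω| ≤ ε := by
          by_contra h2
          exact hω (subset_toMeasurable _ _ (by simpa using h2))
        have e : Complex.exp (t * ((W n ω + V n ω : ℝ) : ℂ) * Complex.I)
            - Complex.exp (t * W n ω * Complex.I) = Complex.exp ((t * W n ω : ℝ) * Complex.I) *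
              (Complex.exp (Complex.I * (t * V n ω : ℝ)) - 1) := by
          rw [mul_sub, ← Complex.exp_add, mul_one]
          push_cast
          ring_nf
        rw [e, norm_mul, Complex.norm_exp_ofReal_mul_I, one_mul]
        refine (Real.norm_exp_I_mul_ofReal_sub_one_le).trans ?_
        rw [Real.norm_eq_abs, abs_mul]
        gcongr
    · rw [integral_add (integrable_const _) ((integrable_const _).indicator hBm),
        integral_indicator_const _ hBm]
      simp [mul_comm]
  have h0 : Tendsto (fun n => charFun ((μ n).map fun ω => W n ω + V n ω) t
      - charFun ((μ n).map (W n)) t) atTop (𝓝 0) := by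
    rw [Metric.tendsto_atTop']
    intro δ hδ
    have hε : 0 < δ / (2 * (|t| + 1)) := by positivity
    obtain ⟨N, hN⟩ := eventually_atTop.1 ((hV0 _ hε).eventually_lt_const
      (by positivity : 0 < δ / 4))
    refine ⟨N, fun n hn => ?_⟩
    rw [dist_zero_right]
    refine lt_of_le_of_lt (hdiff _ hε n) ?_
    have h1 := hN n hn.le
    have h2 : |t| * (δ / (2 * (|t| + 1))) ≤ δ / 2 := by
      rw [← mul_div_assoc, div_le_div_iff₀ (by positivity) (by positivity)]
      nlinarith [abs_nonneg t]
    linarith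
  simpa using h0.add h

end Orders

/-! ### Union bound over the test vectors -/

section Concentration

variable {n p : ℕ} {L K : ℝ} {P : Measure (Fin p → ℝ)} [IsProbabilityMeasure P]
  {Ω : Type*} [MeasurableSpace Ω] {μ : Measure Ω} [IsProbabilityMeasure μ]
  {X : Fin n → Ω → Fin p → ℝ}

/-- The sample covariance matrix is uniformly close to its mean on all pairs of test vectors, with
high probability. -/
lemma measureReal_exists_testVec_le (hL : 1 ≤ L) (hK : 0 < K) (hS : BoundedSpectrum L P)
    (hG : SubGaussian K P) (hmean : ∀ k, ∫ x, x k ∂P = 0) (hX : ∀ i, HasLaw (X i) P μ)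
    (hind : iIndepFun X μ) (hn : 0 < n) (hp : 0 < p) {M q : ℝ} (hM : 0 ≤ M)
    (hq : M ^ 2 = 192 * (K ^ 2 * L ^ 2) ^ 2 * q)
    (hr : M * √(Real.log p / n) ≤ 48 * (K ^ 2 * L ^ 2)) :
    μ.real {ω | ∃ ab : (Fin p ⊕ Fin p) × (Fin p ⊕ Fin p), M * √(Real.log p / n) <
      |bil (sampleCov (dataMatrix X ω) - popCov P) (testVec (precision P) ab.1)
        (testVec (precision P) ab.2)|} ≤ 8 * Real.exp ((2 - q) * Real.log p) := by
  have hn' : (0 : ℝ) < n := by exact_mod_cast hn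
  have hp' : (0 : ℝ) < p := by exact_mod_cast hp
  have hL0 : 0 < L := by linarith
  have hlog : 0 ≤ Real.log p := Real.log_natCast_nonneg p
  have h1 : ∀ ab : (Fin p ⊕ Fin p) × (Fin p ⊕ Fin p), μ.real {ω | M * √(Real.log p / n) <
      |bil (sampleCov (dataMatrix X ω) - popCov P) (testVec (precision P) ab.1)
        (testVec (precision P) ab.2)|} ≤ 2 * Real.exp (-(q * Real.log p)) := by
    intro ab
    have := hG.tail_bil hK hL0 hmean hX hind hn (hS.testVec_sq_le hL ab.1)
      (hS.testVec_sq_le hL ab.2) (by positivity) hr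
    refine this.trans (le_of_eq ?_)
    congr 3
    rw [mul_pow, Real.sq_sqrt (by positivity), hq]
    field_simp
  rw [Set.ofPred_exists]
  refine (measureReal_iUnion_fintype_le _).trans ((Finset.sum_le_sum fun ab _ => h1 ab).trans ?_)
  simp only [Finset.sum_const, Finset.card_univ, Fintype.card_prod, Fintype.card_sum,
    Fintype.card_fin, nsmul_eq_mul]
  refine le_of_eq ?_
  -- There are `(2p)²` pairs of test vectors, each failing with probability at most `2p^{-q}`.
  have e : Real.exp ((2 - q) * Real.log p) = (p : ℝ) ^ 2 * Real.exp (-(q * Real.log p)) := by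
    rw [sub_mul, sub_eq_add_neg, Real.exp_add]
    congr 1
    rw [two_mul, Real.exp_add, Real.exp_log hp', sq]
  rw [e]
  push_cast
  ring

end Concentration

/-! ### Stochastic rate of the remainder and the limit law -/

section Remainder

/-- The remainder in the linear expansion of the de-biased estimator. -/
noncomputable def remainder {n p : ℕ} (P : Measure (Fin p → ℝ)) (X : Matrix (Fin n) (Fin p) ℝ)
    (lam : ℝ) (γ : (j : Fin p) → {k : Fin p // k ≠ j} → ℝ) : Matrix (Fin p) (Fin p) ℝ :=
  debiased X lam γ - precision P + precision P * (sampleCov X - popCov P) * precision P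

lemma measureReal_remainder_le {n p : ℕ} {L K : ℝ} {P : Measure (Fin p → ℝ)}
    [IsProbabilityMeasure P] {Ω : Type*} [MeasurableSpace Ω] {μ : Measure Ω}
    [IsProbabilityMeasure μ] {X : Fin n → Ω → Fin p → ℝ} {lam A s M q B : ℝ}
    {γ : Ω → (j : Fin p) → {k : Fin p // k ≠ j} → ℝ}
    (hL : 1 ≤ L) (hK : 0 < K) (hS : BoundedSpectrum L P)
    (hG : SubGaussian K P) (hmean : ∀ k, ∫ x, x k ∂P = 0) (hX : ∀ i, HasLaw (X i) P μ)
    (hind : iIndepFun X μ) (hn : 0 < n) (hp : 0 < p) (hM : 0 ≤ M)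
    (hq : M ^ 2 = 192 * (K ^ 2 * L ^ 2) ^ 2 * q)
    (hr : M * √(Real.log p / n) ≤ 48 * (K ^ 2 * L ^ 2))
    (hs : SmallScale L A (sparsity P) (M * √(Real.log p / n)) lam s)
    (hA : (0 < lam ∧ 4 * L ^ 3 * (M * √(Real.log p / n)) ≤ lam ∧ 100 * L ^ 4 ≤ A) ∨ (p : ℝ) ≤ A)
    (hγ : ∀ᵐ ω ∂μ, ∀ j, IsSqrtLasso (dataMatrix X ω) lam j (γ ω j))
    (hB : 301200 * L ^ 11 * A * (sparsity P * s ^ 2) ≤ B) :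
    μ.real {ω | B < |supNorm (remainder P (dataMatrix X ω) lam (γ ω))|} ≤
      8 * Real.exp ((2 - q) * Real.log p) := by
  -- Almost surely, a large remainder forces the closeness event to fail; the inclusion holds only
  -- a.e. since minimality does.
  refine le_trans (ENNReal.toReal_mono (measure_ne_top _ _) (measure_mono_ae ?_))
    (measureReal_exists_testVec_le hL hK hS hG hmean hX hind hn hp hM hq hr)
  filter_upwards [hγ] with ω hω
  intro h
  by_contra hnot
  have hclose : ∀ a b, |bil (sampleCov (dataMatrix X ω) - popCov P) (testVec (precision P) a)
      (testVec (precision P) b)| ≤ M * √(Real.log p / n) := by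
    intro a b
    by_contra hab
    exact hnot ⟨(a, b), not_le.1 hab⟩
  have hsup := supNorm_remainder_le hS.precision_mul hS.mul_precision (precision_isSymm P) hp
    (hS.columnModel hL) (closeAt_of_testVec hclose) hs hω hA
  have h0 : 0 ≤ supNorm (remainder P (dataMatrix X ω) lam (γ ω)) :=
    Real.iSup_nonneg fun _ => abs_nonneg _
  change B < |supNorm (remainder P (dataMatrix X ω) lam (γ ω))| at h
  rw [abs_of_nonneg h0] at h
  exact absurd (hsup.trans hB) (not_le.2 h)

/-- If `d = o(√n / log p)` then `√n d log p / n` tends to zero. -/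
lemma tendsto_sparsity_mul_log {d : ℕ → ℝ} {p : ℕ → ℕ}
    (hd : d =o[atTop] fun n : ℕ => √(n : ℝ) / Real.log (p n)) :
    Tendsto (fun n : ℕ => d n * Real.log (p n) / √(n : ℝ)) atTop (𝓝 0) := by
  refine hd.tendsto_div_nhds_zero.congr fun n => ?_
  rw [div_div_eq_mul_div]

lemma log_two_le {p : ℕ} (hp : 2 ≤ p) : Real.log 2 ≤ Real.log p :=
  Real.log_le_log (by norm_num) (by exact_mod_cast hp)

/-- Since `p ≥ 2`, `√(log p) ≤ log p / √(log 2)`, so the sparsity assumption also gives the weaker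
smallness needed in `SmallScale`. -/
lemma tendsto_sparsity_mul_rate {d : ℕ → ℝ} {p : ℕ → ℕ} (hp : ∀ n, 2 ≤ p n) (hd0 : ∀ n, 0 ≤ d n)
    (hd : d =o[atTop] fun n : ℕ => √(n : ℝ) / Real.log (p n)) :
    Tendsto (fun n : ℕ => d n * √(Real.log (p n) / n)) atTop (𝓝 0) := by
  have h2 : 0 < Real.log 2 := Real.log_pos (by norm_num)
  have h := (tendsto_sparsity_mul_log hd).const_mul (√(Real.log 2))⁻¹
  rw [mul_zero] at h
  refine squeeze_zero (fun n => mul_nonneg (hd0 n) (Real.sqrt_nonneg _)) (fun n => ?_) h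
  have hl := log_two_le (hp n)
  have hs2 : 0 < √(Real.log 2) := Real.sqrt_pos.2 h2
  have hsl : √(Real.log 2) ≤ √(Real.log (p n)) := Real.sqrt_le_sqrt hl
  rw [Real.sqrt_div (by linarith)]
  have e : √(Real.log 2) * √(Real.log (p n)) ≤ Real.log (p n) := by
    calc √(Real.log 2) * √(Real.log (p n)) ≤ √(Real.log (p n)) * √(Real.log (p n)) := by gcongr
      _ = Real.log (p n) := Real.mul_self_sqrt (by linarith)
  rw [← mul_div_assoc, ← mul_div_assoc]
  refine div_le_div_of_nonneg_right ?_ (Real.sqrt_nonneg _)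
  rw [← div_eq_inv_mul, le_div_iff₀ hs2]
  calc d n * √(Real.log (p n)) * √(Real.log 2)
      = d n * (√(Real.log 2) * √(Real.log (p n))) := by ring
    _ ≤ d n * Real.log (p n) := mul_le_mul_of_nonneg_left e (hd0 n)

/-- For every `ε > 0` there is a deviation level with failure probability at most `ε`, uniformly
in `p ≥ 2`. -/
lemma exists_exponent {ε : ℝ} (hε : 0 < ε) :
    ∃ q : ℝ, 0 ≤ q ∧ ∀ p : ℕ, 2 ≤ p → 8 * Real.exp ((2 - q) * Real.log p) ≤ ε := by
  have h2 : 0 < Real.log 2 := Real.log_pos (by norm_num)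
  refine ⟨2 + max 0 (Real.log (8 / ε) / Real.log 2), by positivity, fun p hp => ?_⟩
  set y := max 0 (Real.log (8 / ε) / Real.log 2)
  have hy0 : 0 ≤ y := le_max_left _ _
  have hy : Real.log (8 / ε) ≤ y * Real.log 2 := by
    rw [← div_le_iff₀ h2]; exact le_max_right _ _
  have h3 : (2 - (2 + y)) * Real.log p ≤ -Real.log (8 / ε) := by
    have := mul_le_mul_of_nonneg_left (log_two_le hp) hy0
    linarith
  calc 8 * Real.exp ((2 - (2 + y)) * Real.log p) ≤ 8 * Real.exp (-Real.log (8 / ε)) := by gcongr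
    _ = ε := by
      rw [Real.exp_neg, Real.exp_log (by positivity), inv_div]
      field_simp

lemma sparsity_mul_sq_isLittleO {d lam : ℕ → ℝ} {p : ℕ → ℕ} {C₁ : ℝ} (hd0 : ∀ n, 0 ≤ d n)
    (hd : d =o[atTop] fun n : ℕ => √(n : ℝ) / Real.log (p n))
    (hlam : ∀ᶠ n : ℕ in atTop, 0 ≤ lam n ∧ lam n ≤ C₁ * √(Real.log (p n) / n)) :
    (fun n => d n * lam n ^ 2) =o[atTop] fun n : ℕ => 1 / √(n : ℝ) := by
  have h := (tendsto_sparsity_mul_log hd).const_mul (C₁ ^ 2)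
  rw [mul_zero] at h
  rw [isLittleO_iff]
  intro c hc
  filter_upwards [h.eventually_lt_const hc, hlam, eventually_gt_atTop 0] with n h1 ⟨h2, h3⟩ h4
  have hn : (0 : ℝ) < n := by exact_mod_cast h4
  have hlog : 0 ≤ Real.log (p n) := Real.log_natCast_nonneg _
  have hsn : 0 < √(n : ℝ) := Real.sqrt_pos.2 hn
  have hss : √(n : ℝ) * √(n : ℝ) = n := Real.mul_self_sqrt hn.le
  have h5 : lam n ^ 2 ≤ C₁ ^ 2 * (Real.log (p n) / n) := by
    have := pow_le_pow_left₀ h2 h3 2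
    rwa [mul_pow, Real.sq_sqrt (by positivity)] at this
  have hdn := hd0 n
  rw [Real.norm_of_nonneg (by positivity), Real.norm_of_nonneg (by positivity), mul_one_div,
    le_div_iff₀ hsn]
  refine le_trans ?_ h1.le
  calc d n * lam n ^ 2 * √(n : ℝ)
      ≤ d n * (C₁ ^ 2 * (Real.log (p n) / n)) * √(n : ℝ) := by gcongr
    _ = C₁ ^ 2 * (d n * Real.log (p n) / √(n : ℝ)) := by
      rw [show Real.log (p n) / (n : ℝ) = Real.log (p n) / √(n : ℝ) / √(n : ℝ) by
        rw [div_div, hss]]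
      field_simp

section Asymptotic

variable {L K : ℝ} {p : ℕ → ℕ} {P : ∀ n, Measure (Fin (p n) → ℝ)}
  [∀ n, IsProbabilityMeasure (P n)] {Ω : ℕ → Type*} [∀ n, MeasurableSpace (Ω n)]
  {μ : ∀ n, Measure (Ω n)} [∀ n, IsProbabilityMeasure (μ n)]
  {X : ∀ n, Fin n → Ω n → Fin (p n) → ℝ} {lam : ℕ → ℝ} {C₁ : ℝ}
  {γ : ∀ n, Ω n → (j : Fin (p n)) → {k : Fin (p n) // k ≠ j} → ℝ}

/-- The remainder is of the order `d λ²` in probability. -/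
theorem isBigOP_remainder (hL : 1 ≤ L) (hK : 0 < K) (hp : ∀ n, 2 ≤ p n)
    (hX : ∀ n i, HasLaw (X n i) (P n) (μ n)) (hind : ∀ n, iIndepFun (X n) (μ n))
    (hmean : ∀ n k, ∫ x, x k ∂(P n) = 0) (hS : ∀ n, BoundedSpectrum L (P n))
    (hG : ∀ n, SubGaussian K (P n))
    (hd : (fun n => (sparsity (P n) : ℝ)) =o[atTop] fun n => √(n : ℝ) / Real.log (p n))
    (hlam : ∀ᶠ n : ℕ in atTop, 96 * L ^ 3 * (K ^ 2 * L ^ 2) * √(Real.log (p n) / n) ≤ lam n ∧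
      lam n ≤ C₁ * √(Real.log (p n) / n))
    (hγ : ∀ᶠ n in atTop, ∀ᵐ ω ∂(μ n), ∀ j, IsSqrtLasso
        (dataMatrix (X n) ω) (lam n) j (γ n ω j)) :
    IsBigOP μ (fun n ω => supNorm (remainder (P n) (dataMatrix (X n) ω) (lam n) (γ n ω)))
      (fun n => (sparsity (P n) : ℝ) * lam n ^ 2) := by
  intro ε hε
  set κ := K ^ 2 * L ^ 2 with hκ
  have hκ0 : 0 < κ := by positivity
  obtain ⟨q, hq0, hq⟩ := exists_exponent hε
  -- `M₀` is the level for the exponent `q = 3`, with failure probability `8/p`, and is independent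
  -- of `ε`; `M₁` is the level for the exponent adapted to `ε`.
  set M₀ := 24 * κ with hM₀
  set M₁ := √(192 * κ ^ 2 * q) with hM₁
  have hM₁0 : 0 ≤ M₁ := Real.sqrt_nonneg _
  have hM₁q : M₁ ^ 2 = 192 * κ ^ 2 * q := Real.sq_sqrt (by positivity)
  have hM₀q : M₀ ^ 2 = 192 * κ ^ 2 * 3 := by rw [hM₀]; ring
  -- One compatibility constant serves both regimes: `100L⁴` comes from the cone, and `8/ε` bounds
  -- `p` in the other case.
  set A := 100 * L ^ 4 + 8 / ε with hA
  set s₀ := M₀ + M₁ + |C₁| with hs₀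
  have hs₀pos : 0 < s₀ := by positivity
  have hA1 : 1 ≤ A := by
    have : 1 ≤ L ^ 4 := one_le_pow₀ hL
    have : 0 < 8 / ε := by positivity
    linarith
  have hApos : 0 < A := by linarith
  have hrate := tendsto_sparsity_mul_rate hp (fun n => Nat.cast_nonneg _) hd
  have hsm1 := (hrate.const_mul (s₀ * (258 * L ^ 4 * A))).eventually_lt_const
    (by rw [mul_zero]; exact one_pos)
  have hsm2 := (hrate.const_mul s₀).eventually_lt_const
    (u := 48 * κ) (by rw [mul_zero]; positivity)
  refine ⟨301200 * L ^ 11 * A * (s₀ ^ 2 / (96 * L ^ 3 * κ) ^ 2), ?_⟩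
  filter_upwards [hlam, hγ, hsm1, hsm2, eventually_gt_atTop 0] with n ⟨hl1, hl2⟩ hγn h1 h2 hn
  set r := √(Real.log (p n) / n) with hr
  have hn' : (0 : ℝ) < n := by exact_mod_cast hn
  have hlogpos : 0 < Real.log (p n) :=
    lt_of_lt_of_le (Real.log_pos (by norm_num)) (log_two_le (hp n))
  have hr0 : 0 < r := Real.sqrt_pos.2 (by positivity)
  have hlam0 : 0 < lam n := lt_of_lt_of_le (by positivity) hl1
  have hd1 : (1 : ℝ) ≤ sparsity (P n) := by exact_mod_cast le_max_left 1 _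
  have hlams : lam n ≤ s₀ * r := by
    refine hl2.trans ?_
    gcongr
    have := le_abs_self C₁
    linarith
  have hscale : ∀ M, M ≤ M₀ + M₁ → SmallScale L A (sparsity (P n)) (M * r) (lam n) (s₀ * r) := by
    intro M hM
    refine ⟨hA1, hlam0.le, hlams, ?_, ?_⟩
    · gcongr
      linarith [abs_nonneg C₁]
    · refine le_trans (le_of_eq ?_) h1.le
      ring
  have hrad : ∀ M, M ≤ M₀ + M₁ → M * r ≤ 48 * κ := by
    intro M hM
    refine le_trans ?_ h2.le
    have h3 : r ≤ sparsity (P n) * r := le_mul_of_one_le_left hr0.le hd1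
    have h4 : M ≤ s₀ := by linarith [abs_nonneg C₁]
    exact mul_le_mul h4 h3 hr0.le hs₀pos.le
  -- The lower bound on `λ` converts the rate `r²` into `λ²`, even in the regime where `λ` does not
  -- dominate the noise.
  have hB : 301200 * L ^ 11 * A * (sparsity (P n) * (s₀ * r) ^ 2) ≤
      301200 * L ^ 11 * A * (s₀ ^ 2 / (96 * L ^ 3 * κ) ^ 2) * (sparsity (P n) * lam n ^ 2) := by
    have h5 : ((96 * L ^ 3 * κ) * r) ^ 2 ≤ lam n ^ 2 := by gcongr
    have h6 : (s₀ * r) ^ 2 ≤ s₀ ^ 2 / (96 * L ^ 3 * κ) ^ 2 * lam n ^ 2 := by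
      rw [div_mul_eq_mul_div, le_div_iff₀ (by positivity), mul_pow]
      rw [mul_pow] at h5
      calc s₀ ^ 2 * r ^ 2 * (96 * L ^ 3 * κ) ^ 2 = s₀ ^ 2 * ((96 * L ^ 3 * κ) ^ 2 * r ^ 2) := by
            ring
        _ ≤ _ := by gcongr
    calc 301200 * L ^ 11 * A * (sparsity (P n) * (s₀ * r) ^ 2)
        ≤ 301200 * L ^ 11 * A * (sparsity (P n) *
          (s₀ ^ 2 / (96 * L ^ 3 * κ) ^ 2 * lam n ^ 2)) := by gcongr
      _ = _ := by ring
  have hp0 : 0 < p n := by have := hp n; omega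
  rcases le_or_gt (p n : ℝ) (8 / ε) with hle | hgt
  · refine (measureReal_remainder_le hL hK (hS n) (hG n) (hmean n) (hX n) (hind n) hn hp0 hM₁0
      hM₁q (hrad M₁ (by linarith)) (hscale M₁ (by linarith)) (Or.inr ?_) hγn hB).trans
      (hq (p n) (hp n))
    have : 0 ≤ 100 * L ^ 4 := by positivity
    linarith
  · refine (measureReal_remainder_le hL hK (hS n) (hG n) (hmean n) (hX n) (hind n) hn hp0
      (by positivity) hM₀q (hrad M₀ (by linarith)) (hscale M₀ (by linarith))
      (Or.inl ⟨hlam0, ?_, ?_⟩) hγn hB).trans ?_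
    · refine le_trans (le_of_eq ?_) hl1
      rw [hM₀]; ring
    · have : 0 < 8 / ε := by positivity
      linarith
    · have hpp : (0 : ℝ) < p n := by exact_mod_cast hp0
      rw [show (2 - 3 : ℝ) * Real.log (p n) = -Real.log (p n) by ring, Real.exp_neg,
        Real.exp_log hpp, ← div_eq_mul_inv, div_le_iff₀ hpp]
      rw [div_lt_iff₀ hε] at hgt
      linarith

/-- Asymptotic normality of the entries of the de-biased estimator. -/
theorem tendstoInDistribution_debiased (hL : 1 ≤ L) (hK : 0 < K)
    (hX : ∀ n i, HasLaw (X n i) (P n) (μ n)) (hind : ∀ n, iIndepFun (X n) (μ n))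
    (hmean : ∀ n k, ∫ x, x k ∂(P n) = 0) (hS : ∀ n, BoundedSpectrum L (P n))
    (hG : ∀ n, SubGaussian K (P n)) (hγ : ∀ n j, AEMeasurable (fun ω => γ n ω j) (μ n))
    (hrem : IsLittleOP μ
      (fun n ω => supNorm (remainder (P n) (dataMatrix (X n) ω) (lam n) (γ n ω)))
      (fun n => 1 / √(n : ℝ)))
    (i j : ∀ n, Fin (p n)) {c : ℝ} (hc : 0 < c)
    (hsd : ∀ᶠ n in atTop, c ≤ asympSd (μ n) (X n) (precision (P n)) (i n) (j n)) :
    TendstoInDistribution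
      (fun (n : ℕ) ω => √(n : ℝ) *
        (debiased (dataMatrix (X n) ω) (lam n) (γ n ω) - precision (P n)) (i n) (j n) /
          asympSd (μ n) (X n) (precision (P n)) (i n) (j n))
      atTop (id : ℝ → ℝ) μ (gaussianReal 0 1) := by
  have hL0 : 0 < L := by linarith
  set κ := K ^ 2 * L ^ 2 with hκ
  have hκ0 : 0 < κ := by positivity
  set σ := fun n => asympSd (μ n) (X n) (precision (P n)) (i n) (j n) with hσ
  set α : ∀ n, Fin (p n) → ℝ := fun n k => precision (P n) k (i n)
  set β : ∀ n, Fin (p n) → ℝ := fun n k => precision (P n) k (j n)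
  have hα : ∀ n, ∑ k, α n k ^ 2 ≤ L ^ 2 := fun n => (hS n).sum_col_sq_le hL (i n)
  have hβ : ∀ n, ∑ k, β n k ^ 2 ≤ L ^ 2 := fun n => (hS n).sum_col_sq_le hL (j n)
  set Y : ∀ n, Ω n → ℝ := fun n ω => √(n : ℝ) *
    (debiased (dataMatrix (X n) ω) (lam n) (γ n ω) - precision (P n)) (i n) (j n) / σ n with hY
  have hYm : ∀ n, AEMeasurable (Y n) (μ n) := by
    intro n
    have h := aemeasurable_debiased_apply (lam := lam n) (fun l => (hX n l).aemeasurable) (hγ n)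
      (i n) (j n)
    simp only [hY, Matrix.sub_apply]
    exact ((h.sub_const _).const_mul _).div_const _
  set W : ∀ n, Ω n → ℝ := fun n ω => (-κ / σ n) / √(n : ℝ) *
    ∑ l, crossVar (P n) K L (α n) (β n) (X n) l ω with hW
  have hWm : ∀ n, AEMeasurable (W n) (μ n) := fun n =>
    (Finset.aemeasurable_fun_sum _ fun l _ => (hasLaw_crossVar (hX n) l).aemeasurable).const_mul _
  have hWlim : ∀ t : ℝ, Tendsto (fun n => charFun ((μ n).map (W n)) t) atTop
      (𝓝 (Complex.exp (-t ^ 2 / 2))) := by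
    intro t
    refine tendsto_charFun_row_sum (C := κ / c)
      (fun n => (hG n).centeredExp hK hL0 (hα n) (hβ n)) (fun n l => hasLaw_crossVar (hX n) l)
      (fun n => iIndepFun_crossVar (hind n)) ?_ t
    filter_upwards [hsd, eventually_gt_atTop 0] with n h1 hn
    have hσn : 0 < σ n := lt_of_lt_of_le hc h1
    have hsq : σ n ^ 2 = κ ^ 2 * ∫ x, x ^ 2 ∂(crossLaw (P n) K L (α n) (β n)) :=
      (hG n).asympSd_sq hK hL0 (hmean n) (hX n) (hind n) hn (hα n) (hβ n)
    constructor
    · rw [div_pow, neg_sq, div_mul_eq_mul_div, ← hsq, div_self (by positivity)]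
    · rw [abs_div, abs_neg, abs_of_pos hκ0, abs_of_pos hσn]
      gcongr
  have hVm : ∀ n, AEMeasurable (fun ω => Y n ω - W n ω) (μ n) := fun n => (hYm n).sub (hWm n)
  have hVeq : ∀ n, 0 < n → ∀ ω, Y n ω - W n ω = √(n : ℝ) *
      remainder (P n) (dataMatrix (X n) ω) (lam n) (γ n ω) (i n) (j n) / σ n := by
    intro n hn ω
    have hsn : 0 < √(n : ℝ) := Real.sqrt_pos.2 (by exact_mod_cast hn)
    have hss : √(n : ℝ) * √(n : ℝ) = n := Real.mul_self_sqrt (Nat.cast_nonneg n)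
    have h1 : (precision (P n) * (sampleCov (dataMatrix (X n) ω) - popCov (P n)) *
        precision (P n)) (i n) (j n) =
        κ / n * ∑ l, crossVar (P n) K L (α n) (β n) (X n) l ω := by
      rw [← (hG n).bil_sampleCov_sub hK hL0 (hmean n) hn (α := α n) (β := β n),
        ← mul_mul_apply_eq_bil, (precision_isSymm (P n)).eq]
    simp only [hY, hW, remainder, Matrix.add_apply, h1]
    rw [show κ / (n : ℝ) = κ / √(n : ℝ) / √(n : ℝ) by rw [div_div, hss]]
    field_simp
    ring
  -- The difference is `√n` times an entry of the remainder divided by `σ n ≥ c`, so the lower bound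
  -- on the standard deviation is essential.
  have hV0 : IsLittleOP μ (fun n ω => Y n ω - W n ω) fun _ => 1 := by
    intro ε hε
    refine squeeze_zero' (Eventually.of_forall fun n => measureReal_nonneg) ?_
      (hrem (ε * c) (by positivity))
    filter_upwards [hsd, eventually_gt_atTop 0] with n h1 hn
    have hσn : 0 < σ n := lt_of_lt_of_le hc h1
    have hsn : 0 < √(n : ℝ) := Real.sqrt_pos.2 (by exact_mod_cast hn)
    refine measureReal_mono fun ω hω => ?_
    simp only [Set.mem_ofPred_eq, mul_one] at hω ⊢
    rw [hVeq n hn, abs_div, abs_mul, abs_of_pos hsn, abs_of_pos hσn, lt_div_iff₀ hσn] at hω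
    rw [mul_one_div, div_lt_iff₀ hsn]
    have h2 : |remainder (P n) (dataMatrix (X n) ω) (lam n) (γ n ω) (i n) (j n)| ≤
        supNorm (remainder (P n) (dataMatrix (X n) ω) (lam n) (γ n ω)) :=
      le_ciSup (f := fun ij : Fin (p n) × Fin (p n) =>
        |remainder (P n) (dataMatrix (X n) ω) (lam n) (γ n ω) ij.1 ij.2|)
        (Set.finite_range _).bddAbove (i n, j n)
    have h3 := le_abs_self (supNorm (remainder (P n) (dataMatrix (X n) ω) (lam n) (γ n ω)))
    calc ε * c ≤ ε * σ n := by gcongr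
      _ < √(n : ℝ) * |remainder (P n) (dataMatrix (X n) ω) (lam n) (γ n ω) (i n) (j n)| := hω
      _ ≤ √(n : ℝ) * |supNorm (remainder (P n) (dataMatrix (X n) ω) (lam n) (γ n ω))| :=
        mul_le_mul_of_nonneg_left (h2.trans h3) hsn.le
      _ = _ := mul_comm _ _
  refine ⟨hYm, aemeasurable_id, ProbabilityMeasure.tendsto_iff_tendsto_charFun.2 fun t => ?_⟩
  have h := tendsto_charFun_add_of_isLittleOP hWm hVm (hWlim t) hV0
  simp only [add_sub_cancel] at h
  have hlim : charFun ((gaussianReal 0 1).map id) t = Complex.exp (-t ^ 2 / 2) := by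
    rw [Measure.map_id, charFun_gaussianReal]
    congr 1
    simp
    ring
  change Tendsto (fun n => charFun ((μ n).map (Y n)) t) atTop
    (𝓝 (charFun ((gaussianReal 0 1).map id) t))
  rw [hlim]
  exact h

end Asymptotic

end Remainder

end NodewiseSqrtLasso

theorem mainTheorem1 (L K : ℝ) (hL : 1 ≤ L) (hK : 0 < K) :
    -- how large the constant in the tuning parameter must be depends on `L` and `K` only
    ∃ C₀ : ℝ, 0 < C₀ ∧
    ∀ (p : ℕ → ℕ) (P : ∀ n, Measure (Fin (p n) → ℝ)) [∀ n, IsProbabilityMeasure (P n)]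
      (Ω : ℕ → Type*) [∀ n, MeasurableSpace (Ω n)]
      (μ : ∀ n, Measure (Ω n)) [∀ n, IsProbabilityMeasure (μ n)]
      (X : ∀ n, Fin n → Ω n → Fin (p n) → ℝ)
      (lam : ℕ → ℝ) (C₁ : ℝ)
      (γ : ∀ n, Ω n → (j : Fin (p n)) → {k : Fin (p n) // k ≠ j} → ℝ),
      (∀ n, 2 ≤ p n) →
      -- `n` independent observations with law `P n`, which is centred
      (∀ n i, HasLaw (X n i) (P n) (μ n)) →
      (∀ n, iIndepFun (X n) (μ n)) →
      (∀ n k, ∫ x, x k ∂(P n) = 0) →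
      (∀ n, BoundedSpectrum L (P n)) →
      (∀ n, SubGaussian K (P n)) →
      -- sparsity: `d = o(√n / log p)`
      ((fun n => (sparsity (P n) : ℝ)) =o[atTop]
        fun n => √(n : ℝ) / Real.log (p n)) →
      -- tuning parameter of the order `√(log p / n)`
      (∀ᶠ n : ℕ in atTop, C₀ * √(Real.log (p n) / n) ≤ lam n ∧
        lam n ≤ C₁ * √(Real.log (p n) / n)) →
      -- any measurable choice of solutions of the nodewise regressions
      (∀ n j, AEMeasurable (fun ω => γ n ω j) (μ n)) →
      (∀ᶠ n in atTop, ∀ᵐ ω ∂(μ n), ∀ j, IsSqrtLasso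
        (dataMatrix (X n) ω) (lam n) j (γ n ω j)) →
      (∃ rem : ∀ n, Ω n → Matrix (Fin (p n)) (Fin (p n)) ℝ,
        (∀ n ω, debiased (dataMatrix (X n) ω) (lam n) (γ n ω) - precision (P n) =
          -(precision (P n) * (sampleCov (dataMatrix (X n) ω) - popCov (P n)) * precision (P n))
            + rem n ω) ∧
        IsBigOP μ (fun n ω => supNorm (rem n ω)) (fun n => (sparsity (P n) : ℝ) * lam n ^ 2) ∧
        IsLittleOP μ (fun n ω => supNorm (rem n ω)) (fun n => 1 / √(n : ℝ))) ∧
      ∀ i j : ∀ n, Fin (p n),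
        -- the limit law holds for entries with variance bounded away from zero
        (∃ c : ℝ, 0 < c ∧ ∀ᶠ n in atTop, c ≤ asympSd (μ n) (X n) (precision (P n)) (i n) (j n)) →
        TendstoInDistribution
          (fun (n : ℕ) ω => √(n : ℝ) *
            (debiased (dataMatrix (X n) ω) (lam n) (γ n ω) - precision (P n)) (i n) (j n) /
              asympSd (μ n) (X n) (precision (P n)) (i n) (j n))
          atTop (id : ℝ → ℝ) μ (gaussianReal 0 1) := by
  -- This is `4L³ · 24κ` with `κ = K²L²`: exactly what the cone condition `4L³ρ ≤ λ` requires at the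
  -- level `ρ = 24κ √(log p / n)`.
  refine ⟨96 * L ^ 3 * (K ^ 2 * L ^ 2), by positivity, ?_⟩
  intro p P _ Ω _ μ _ X lam C₁ γ hp hX hind hmean hS hG hd hlam hγm hγ
  have hbig := isBigOP_remainder hL hK hp hX hind hmean hS hG hd hlam hγ
  have hlam' : ∀ᶠ n : ℕ in atTop, 0 ≤ lam n ∧ lam n ≤ C₁ * √(Real.log (p n) / n) := by
    filter_upwards [hlam] with n hn
    exact ⟨le_trans (by positivity) hn.1, hn.2⟩
  have hlittle := hbig.isLittleOP (sparsity_mul_sq_isLittleO (fun n => Nat.cast_nonneg _) hd hlam')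
    fun n => by positivity
  refine ⟨⟨fun n ω => remainder (P n) (dataMatrix (X n) ω) (lam n) (γ n ω), fun n ω => ?_,
    hbig, hlittle⟩, ?_⟩
  · simp only [remainder]
    abel
  · rintro i j ⟨c, hc, hsd⟩
    exact tendstoInDistribution_debiased hL hK hX hind hmean hS hG hγm hlittle i j hc hsd
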